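/- Let $F$ be a field of prime characteristic $p$ and let $(L,[p])$ be a restricted Lie algebra over $F$ (of arbitrary dimension), i.e. a Lie algebra with a map $x\mapsto x^{[p]}$ on $L$ such that $\operatorname{ad} a^{[p]}=(\operatorname{ad} a)^p$, $(\alpha a)^{[p]}=\alpha^p a^{[p]}$ and $(a+b)^{[p]}=a^{[p]}+b^{[p]}+\sum_{i=1}^{p-1}s_i(a,b)$ for all $a,b\in L$, $\alpha\in F$, where the $s_i(a,b)\in L$ are given by $(\operatorname{ad}(a\otimes X+b\otimes 1))^{p-1}(a\otimes 1)=\sum_{i=1}^{p-1} i\,s_i(a,b)\otimes X^{i-1}$ in $L\otimes_F F[X]$. Let $S\in L^*$ be a linear form. An $S$-reduced universal enveloping algebra of $L$ is a pair $(u,\iota)$ consisting of a unital associative $F$-algebra $u$ and a Lie algebra homomorphism $\iota:L\to u$ (for the commutator bracket on $u$) with $\iota(x)^p-\iota(x^{[p]})=S(x)^p\,1$ for all $x\in L$, such that for every unital associative $F$-algebra $A$ and every Lie algebra homomorphism $f:L\to A$ with $f(x)^p-f(x^{[p]})=S(x)^p\,1$ for all $x\in L$ there is a unique homomorphism of unital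 $F$-algebras $\bar f:u\to A$ with $\bar f\circ\iota=f$. Then: (1) The $S$-reduced universal enveloping algebra exists: let $J$ be the two-sided ideal of the universal enveloping algebra $U(L)$ generated by all $x^p-x^{[p]}-S(x)^p\,1$ with $x\in L$; then $u(L,S):=U(L)/J$, together with the canonical map $L\to U(L)\to U(L)/J$, is an $S$-reduced universal enveloping algebra of $L$. (2) Let $(u,\iota)$ be any $S$-reduced universal enveloping algebra of $L$ and let $(e_i)_{i\in I}$ be a basis of $L$ indexed by a totally ordered set $I$. For a finitely supported $n:I\to\mathbb N$ with support $i_1<\dots<i_k$ write $\iota(e)^n:=\iota(e_{i_1})^{n(i_1)}\cdots\iota(e_{i_k})^{n(i_k)}$. Then the family of the elements $\iota(e)^n$, over all finitely supported $n:I\to\mathbb N$ with $0\le n(i)<p$ for all $i\in I$, is a basis of $u$ over $F$. (3) If $L$ is finite-dimensional, then every $S$-reduced universal enveloping algebra $u$ of $L$ is finite-dimensional and $\dim_F u=p^{\dim_F L}$. -/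

import Mathlib

open scoped TensorProduct Polynomial

universe u v w t z

-- The commutator bracket on associative rings, as for the universal enveloping algebra in Mathlib.
attribute [local instance 100] LieRing.ofAssociativeRing

/-- `φ : L → L`, written `x ↦ x^{[p]}`, is a `p`-mapping on the Lie algebra `L` over `F`, so that
`(L, φ)` is a restricted Lie algebra. In the last condition the elements `s i`, `1 ≤ i ≤ p - 1`,
are the `s_i(a, b)` that the displayed identity in `F[X] ⊗ L` determines when `char F = p`. -/
structure IsPMapping (F : Type*) {L : Type*} [Field F] [LieRing L] [LieAlgebra F L]
    (p : ℕ) (φ : L → L) : Prop where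
  ad_map : ∀ a : L, LieAlgebra.ad F L (φ a) = LieAlgebra.ad F L a ^ p
  map_smul : ∀ (α : F) (a : L), φ (α • a) = α ^ p • φ a
  map_add : ∀ a b : L, ∃ s : ℕ → L,
    (LieAlgebra.ad F[X] (F[X] ⊗[F] L)
        ((Polynomial.X : F[X]) ⊗ₜ[F] a + (1 : F[X]) ⊗ₜ[F] b) ^ (p - 1)) ((1 : F[X]) ⊗ₜ[F] a) =
      ∑ i ∈ Finset.Icc 1 (p - 1), (Polynomial.X ^ (i - 1) : F[X]) ⊗ₜ[F] (i • s i) ∧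
    φ (a + b) = φ a + φ b + ∑ i ∈ Finset.Icc 1 (p - 1), s i

/-- `f(x)^p - f(x^{[p]}) = S(x)^p 1` for all `x`. -/
def HasPCharacter {F L A : Type*} [Field F] [LieRing L] [LieAlgebra F L]
    [Ring A] [Algebra F A] (p : ℕ) (φ : L → L) (S : Module.Dual F L) (f : L →ₗ⁅F⁆ A) : Prop :=
  ∀ x : L, f x ^ p - f (φ x) = S x ^ p • (1 : A)

/-- The pair `(U, ι)` is an `S`-reduced universal enveloping algebra of `(L, φ)`: the universal
property is tested against all unital associative algebras in the universe `r`. -/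
structure IsReducedEnvelopingAlgebra.{r, a, b, c} {F : Type a} {L : Type b} {U : Type c}
    [Field F] [LieRing L] [LieAlgebra F L] [Ring U] [Algebra F U]
    (p : ℕ) (φ : L → L) (S : Module.Dual F L) (ι : L →ₗ⁅F⁆ U) : Prop where
  hasPCharacter : HasPCharacter p φ S ι
  existsUnique_lift : ∀ (A : Type r) [Ring A] [Algebra F A] (f : L →ₗ⁅F⁆ A),
    HasPCharacter p φ S f → ∃! g : U →ₐ[F] A, ∀ x : L, g (ι x) = f x

section Construction

variable (F : Type*) {L : Type*} [Field F] [LieRing L] [LieAlgebra F L]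
  (p : ℕ) (φ : L → L) (S : Module.Dual F L)

/-- The two-sided ideal of `U(L)` generated by all `x^p - x^{[p]} - S(x)^p 1`, `x ∈ L`. -/
def reducedIdeal : TwoSidedIdeal (UniversalEnvelopingAlgebra F L) :=
  TwoSidedIdeal.span (Set.range fun x : L =>
    UniversalEnvelopingAlgebra.ι F x ^ p - UniversalEnvelopingAlgebra.ι F (φ x)
      - S x ^ p • (1 : UniversalEnvelopingAlgebra F L))

/-- `u(L, S) = U(L) / (x^p - x^{[p]} - S(x)^p 1 : x ∈ L)`. -/
def ReducedEnvelopingAlgebra : Type _ := (reducedIdeal F p φ S).ringCon.Quotient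

instance : Ring (ReducedEnvelopingAlgebra F p φ S) :=
  inferInstanceAs (Ring (reducedIdeal F p φ S).ringCon.Quotient)

instance : Algebra F (ReducedEnvelopingAlgebra F p φ S) :=
  inferInstanceAs (Algebra F (reducedIdeal F p φ S).ringCon.Quotient)

/-- The canonical projection `U(L) → u(L, S)`. -/
def ReducedEnvelopingAlgebra.mk :
    UniversalEnvelopingAlgebra F L →ₐ[F] ReducedEnvelopingAlgebra F p φ S :=
  RingCon.mkₐ F (reducedIdeal F p φ S).ringCon

/-- The canonical map `L → U(L) → u(L, S)`. -/
def ReducedEnvelopingAlgebra.ι : L →ₗ⁅F⁆ ReducedEnvelopingAlgebra F p φ S :=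
  (ReducedEnvelopingAlgebra.mk F p φ S).toLieHom.comp (UniversalEnvelopingAlgebra.ι F)

end Construction

/-- The ordered monomial `y^n = y_{i₁}^{n(i₁)} ⋯ y_{iₖ}^{n(iₖ)}`, where `i₁ < ⋯ < iₖ` are the
indices at which `n` does not vanish. -/
def orderedMonomial {I A : Type*} [LinearOrder I] [Ring A] (y : I → A) (n : I →₀ ℕ) : A :=
  ((n.support.sort (· ≤ ·)).map fun i => y i ^ n i).prod

/-! Fix an ordered basis `e` of `L` and rewrite words in its letters by two rules: for `i < j` the
factor `e_j e_i` becomes `e_i e_j + [e_j, e_i]`, and `e_i ^ p` becomes `e_i^{[p]} + S(e_i)^p`. Both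
rules lower a word with respect to length, then number of inversions, and the irreducible words are
exactly the sorted words in which every letter occurs fewer than `p` times. By Bergman's diamond
lemma (`exists_basis_of_reductions`) they give a basis of the quotient as soon as any two reductions
of a word agree modulo relations on smaller words. The Poincaré–Birkhoff–Witt theorem is not used.

Disjoint reductions agree for formal reasons. The overlaps are `k j i`, resolved by the Jacobi
identity (`swap_swap_mem`); `j i^p` and `j^p i`, resolved by `ad x^{[p]} = (ad x)^p` and the
characteristic `p` formula `(ad x)^(p-1) a = ∑ x^k a x^(p-1-k)` (`swap_pow_mem`, `pow_swap_mem`);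
and `i^(p+k)`, resolved by `[x^{[p]}, x] = 0` (`pow_pow_mem`).

The presentation imposes the `p`-power relation only at basis vectors. Jacobson's formula for `(a +
b)^p` (`LieHom.map_add_pow_char`) propagates it to all of `L` (`HasPCharacter.of_basis`), so the
presented algebra is `u(L, S)`. The universal property carries the basis to every `u`, and counting
exponents gives the dimension. -/

section Jacobson

/-! ### Jacobson's formula for the `p`-th power of a sum. -/

/-- By Pascal's rule adjacent entries of row `p - 1` add up to an inner entry of row `p`, which
vanishes. The hypothesis `(p : R) = 0` replaces `CharP R p` so that the trivial ring is covered. -/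
theorem Nat.Prime.cast_choose_pred {p : ℕ} (hp : p.Prime) {R : Type*} [Ring R] (hR : (p : R) = 0) :
    ∀ k < p, (((p - 1).choose k : ℕ) : R) = (-1) ^ k
  | 0, _ => by simp
  | k + 1, hk => by
    have h1 : p.choose (k + 1) = (p - 1).choose k + (p - 1).choose (k + 1) := by
      conv_lhs => rw [← Nat.sub_add_cancel hp.one_le]
      rw [Nat.choose_succ_succ]
    have h2 : ((p.choose (k + 1) : ℕ) : R) = 0 := by
      obtain ⟨c, hc⟩ := hp.dvd_choose_self (Nat.succ_ne_zero k) hk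
      rw [hc, Nat.cast_mul, hR, zero_mul]
    rw [h1, Nat.cast_add, hp.cast_choose_pred hR k (by omega)] at h2
    rw [pow_succ, mul_neg_one]
    exact (neg_eq_of_add_eq_zero_right h2).symm

theorem Commute.sub_pow_pred_char {p : ℕ} (hp : p.Prime) {R : Type*} [Ring R] (hR : (p : R) = 0)
    {a b : R} (h : Commute a b) :
    (a - b) ^ (p - 1) = ∑ k ∈ Finset.range p, a ^ k * b ^ (p - 1 - k) := by
  rw [sub_eq_add_neg, h.neg_right.add_pow, Nat.sub_add_cancel hp.one_le]
  refine Finset.sum_congr rfl fun k hk => ?_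
  have hk := Finset.mem_range.1 hk
  -- Symmetry turns the binomial into `(-1) ^ (p - 1 - k)`, which cancels the sign of `(-b) ^ (p - 1
  -- - k)` for every `p`, including `p = 2`.
  rw [← Nat.choose_symm (by omega), hp.cast_choose_pred hR _ (by omega), neg_pow b, mul_assoc,
    mul_assoc, ← ((Commute.neg_one_left (b ^ (p - 1 - k))).pow_left _).eq, ← mul_assoc ((-1) ^ _), ← mul_pow,
    neg_one_mul, neg_neg, one_pow, one_mul]
  exact Commute.refl _

theorem LieAlgebra.ad_pow_pred_char {p : ℕ} (hp : p.Prime) {F A : Type*} [CommRing F] [CharP F p]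
    [Ring A] [Algebra F A] (x a : A) :
    (LieAlgebra.ad F A x ^ (p - 1)) a = ∑ k ∈ Finset.range p, x ^ k * a * x ^ (p - 1 - k) := by
  have hz : (p : Module.End F A) = 0 := by
    rw [← map_natCast (algebraMap F (Module.End F A)), CharP.cast_eq_zero, map_zero]
  rw [LieAlgebra.ad_eq_lmul_left_sub_lmul_right, Pi.sub_apply,
    Commute.sub_pow_pred_char hp hz (LinearMap.commute_mulLeft_right x x)]
  simp [LinearMap.sum_apply, mul_assoc]

/-- Two scalar rings are needed because `F[X] ⊗ L` is taken over `F[X]` and `A[X]` over `F`. -/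
theorem LieAlgebra.map_ad_pow_of_map_ad {F G M N : Type*} [CommRing F] [CommRing G] [LieRing M]
    [LieAlgebra F M] [LieRing N] [LieAlgebra G N] (f : M → N) (hf : ∀ x y, f (LieAlgebra.ad F M x y) = ⁅f x, f y⁆)
    (x y : M) (n : ℕ) : f ((LieAlgebra.ad F M x ^ n) y) = (LieAlgebra.ad G N (f x) ^ n) (f y) := by
  induction n with
  | zero => rfl
  | succ n ih => rw [pow_succ', pow_succ', Module.End.mul_apply, Module.End.mul_apply,
      hf, LieAlgebra.ad_apply, ih]

variable {F : Type*} {L : Type*} {A : Type*} [Field F] [LieRing L] [LieAlgebra F L] [Ring A]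
  [Algebra F A]

/-- The extension of `f : L → A` to a map `F[X] ⊗ L → A[X]`. -/
noncomputable def LieHom.tensorPolynomial (f : L →ₗ⁅F⁆ A) : F[X] ⊗[F] L →ₗ[F] A[X] :=
  TensorProduct.lift <|
    (LinearMap.mul F A[X]).compl₁₂ (Polynomial.mapAlgHom (Algebra.ofId F A)).toLinearMap
      ((Polynomial.CAlgHom (R := F) (A := A)).toLinearMap ∘ₗ (f : L →ₗ[F] A))

theorem LieHom.tensorPolynomial_tmul (f : L →ₗ⁅F⁆ A) (q : F[X]) (x : L) :
    f.tensorPolynomial (q ⊗ₜ x) = q.map (algebraMap F A) * Polynomial.C (f x) := rfl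

theorem Polynomial.commute_map_algebraMap (q : F[X]) (r : A[X]) :
    Commute (q.map (algebraMap F A)) r := by
  induction q using Polynomial.induction_on' with
  | add a b ha hb => rw [Polynomial.map_add]; exact ha.add_left hb
  | monomial n c =>
    rw [Polynomial.map_monomial, ← Polynomial.C_mul_X_pow_eq_monomial]
    refine Commute.mul_left ?_ (Polynomial.commute_X_pow r n).symm.symm
    exact Algebra.commutes (A := A[X]) c r

theorem LieHom.tensorPolynomial_lie (f : L →ₗ⁅F⁆ A) (x y : F[X] ⊗[F] L) :
    f.tensorPolynomial (LieAlgebra.ad F[X] (F[X] ⊗[F] L) x y) = ⁅f.tensorPolynomial x, f.tensorPolynomial y⁆ := by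
  induction x with
  | zero => simp only [map_zero, LinearMap.zero_apply, zero_lie]
  | add a b ha hb => simp only [LinearMap.add_apply, map_add, add_lie, ha, hb]
  | tmul q a =>
    induction y with
    | zero => rw [map_zero, map_zero, lie_zero]
    | add a b ha hb => rw [map_add, map_add, map_add, lie_add, ha, hb]
    | tmul r b =>
      rw [LieAlgebra.ad_apply, LieAlgebra.ExtendScalars.bracket_tmul]
      simp only [LieHom.tensorPolynomial_tmul, LieHom.map_lie, LieRing.of_associative_ring_bracket,
        Polynomial.map_mul, Polynomial.C_sub, Polynomial.C_mul, mul_sub]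
      have h1 := Polynomial.commute_map_algebraMap (A := A) q
      have h2 := Polynomial.commute_map_algebraMap (A := A) r
      congr 1
      · rw [mul_assoc, mul_assoc, ← mul_assoc _ (Polynomial.C (f a)), (h2 (Polynomial.C (f a))).eq,
          mul_assoc]
      · rw [(h1 _).eq, mul_assoc, mul_assoc, ← mul_assoc _ (Polynomial.C (f b)),
          (h1 (Polynomial.C (f b))).eq, mul_assoc]

theorem Polynomial.derivative_pow_eq_sum (q : A[X]) (n : ℕ) :
    Polynomial.derivative (q ^ n) =
      ∑ k ∈ Finset.range n, q ^ k * Polynomial.derivative q * q ^ (n - 1 - k) := by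
  induction n with
  | zero => simp
  | succ n ih =>
    rw [pow_succ, Polynomial.derivative_mul, ih, Finset.sum_range_succ, Finset.sum_mul]
    simp only [Nat.add_sub_cancel, Nat.sub_self, pow_zero, mul_one]
    congr 1
    refine Finset.sum_congr rfl fun k hk => ?_
    have hk := Finset.mem_range.1 hk
    rw [mul_assoc, ← pow_succ, show n - 1 - k + 1 = n - k by omega]

theorem Polynomial.coeff_linear_pow (a b : A) (n : ℕ) :
    ((C a * X + C b) ^ n).coeff n = a ^ n ∧ ((C a * X + C b) ^ n).coeff 0 = b ^ n ∧
      ∀ m, n < m → ((C a * X + C b) ^ n).coeff m = 0 := by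
  induction n with
  | zero => simp [Polynomial.coeff_one]; omega
  | succ n ih =>
    obtain ⟨h1, h2, h3⟩ := ih
    have key : ∀ m, ((C a * X + C b) ^ (n + 1)).coeff (m + 1) =
        a * ((C a * X + C b) ^ n).coeff m + b * ((C a * X + C b) ^ n).coeff (m + 1) := by
      intro m
      rw [pow_succ', add_mul, mul_assoc, Polynomial.X_mul, ← mul_assoc, coeff_add, coeff_mul_X,
        coeff_C_mul, coeff_C_mul]
    refine ⟨?_, ?_, ?_⟩
    · rw [key, h1, h3 _ (Nat.lt_succ_self n), mul_zero, add_zero, pow_succ']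
    · rw [pow_succ', mul_coeff_zero, h2, pow_succ']; simp
    · rintro (_ | m) hm
      · omega
      · rw [key, h3 _ (by omega), h3 _ (by omega), mul_zero, mul_zero, add_zero]

/-- Put `q = f(a) X + f(b)`. The derivative of `q ^ p` is `∑ q^k f(a) q^(p-1-k) = (ad q)^(p-1) (f
a)`, the image of the identity defining the `s i`. Comparing coefficients shows that the inner
coefficients of `q ^ p` are the `f (s i)`; the outer ones are `f(a)^p` and `f(b)^p`. Evaluation at
`1` gives the formula. -/
theorem LieHom.map_add_pow_char {p : ℕ} (hp : p.Prime) [CharP F p] (f : L →ₗ⁅F⁆ A) (a b : L)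
    (s : ℕ → L)
    (hs : (LieAlgebra.ad F[X] (F[X] ⊗[F] L)
        ((Polynomial.X : F[X]) ⊗ₜ[F] a + (1 : F[X]) ⊗ₜ[F] b) ^ (p - 1)) ((1 : F[X]) ⊗ₜ[F] a) =
      ∑ i ∈ Finset.Icc 1 (p - 1), (Polynomial.X ^ (i - 1) : F[X]) ⊗ₜ[F] (i • s i)) :
    (f a + f b) ^ p = f a ^ p + f b ^ p + ∑ i ∈ Finset.Icc 1 (p - 1), f (s i) := by
  open Polynomial in
  set q : A[X] := C (f a) * X + C (f b) with hq
  have hd : derivative (q ^ p) = ∑ i ∈ Finset.Icc 1 (p - 1), X ^ (i - 1) * C ((i : A) * f (s i)) := by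
    have h := congrArg f.tensorPolynomial hs
    rw [LieAlgebra.map_ad_pow_of_map_ad (G := F) _ f.tensorPolynomial_lie,
      LieAlgebra.ad_pow_pred_char hp] at h
    simp only [map_add, map_sum, LieHom.tensorPolynomial_tmul, Polynomial.map_X,
      Polynomial.map_one, one_mul, Polynomial.map_pow, map_nsmul] at h
    rw [Polynomial.derivative_pow_eq_sum]
    have hq' : derivative q = C (f a) := by simp [hq]
    rw [hq']
    rw [Polynomial.X_mul, ← hq] at h
    rw [h]
    simp [nsmul_eq_mul]
  obtain ⟨hc1, hc2, hc3⟩ := Polynomial.coeff_linear_pow (f a) (f b) p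
  have hc : ∀ i ∈ Finset.Icc 1 (p - 1), (q ^ p).coeff i = f (s i) := by
    intro i hi
    obtain ⟨hi1, hi2⟩ := Finset.mem_Icc.1 hi
    have h := congrArg (fun r => r.coeff (i - 1)) hd
    simp only [coeff_derivative, finsetSum_coeff, coeff_X_pow_mul'] at h
    rw [Finset.sum_eq_single i] at h
    · rw [if_pos le_rfl, Nat.sub_self, coeff_C_zero, ← Nat.cast_succ, Nat.succ_eq_add_one,
        Nat.sub_add_cancel hi1, ← (Nat.cast_commute i ((q ^ p).coeff i)).eq] at h
      -- The derivative only determines `i` times the coefficient; `0 < i < p` allows division by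
      -- `i`.
      have hu : (i : F) ≠ 0 := by
        rw [Ne, CharP.cast_eq_zero_iff F p]
        intro hdvd
        have := Nat.le_of_dvd hi1 hdvd
        omega
      rw [← map_natCast (algebraMap F A), ← Algebra.smul_def, ← Algebra.smul_def] at h
      exact (smul_right_injective A hu) h
    · intro j hj hji
      obtain ⟨hj1, hj2⟩ := Finset.mem_Icc.1 hj
      split_ifs with hle
      · rw [coeff_C_of_ne_zero (by omega)]
      · rfl
    · exact fun h => absurd hi h
  -- `A` need not be commutative, but evaluation at the central element `1` is multiplicative.
  have hev : (q ^ p).eval 1 = (f a + f b) ^ p := by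
    have h1 : ∀ n, (q ^ n).eval 1 = (f a + f b) ^ n := by
      intro n
      induction n with
      | zero => simp
      | succ n ih =>
        rw [pow_succ, pow_succ, ← ih, eval, eval₂_mul_noncomm _ _ fun k => Commute.one_right _]
        congr 1
        change q.eval 1 = _
        simp [hq]
    exact h1 p
  have hdeg : (q ^ p).natDegree < p + 1 := by
    rw [Nat.lt_succ_iff, Polynomial.natDegree_le_iff_coeff_eq_zero]
    exact hc3
  rw [← hev, eval_eq_sum_range' hdeg, Finset.sum_range_succ, Finset.sum_range_eq_add_Ico _ hp.pos]
  simp only [one_pow, mul_one]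
  rw [hc1, hc2, show Finset.Ico 1 p = Finset.Icc 1 (p - 1) by
    ext i; simp only [Finset.mem_Ico, Finset.mem_Icc]; have := hp.pos; omega,
    Finset.sum_congr rfl hc]
  abel

end Jacobson

/-! ### The diamond lemma in linear form. -/

section Diamond

variable {F M W α : Type*} [CommRing F] [AddCommGroup M] [Module F M] (b : Module.Basis W F M)
  [Preorder α] (μ : W → α) (R : W → M → Prop)

/-- The span of the relations `b w - f` for the reductions `w ↦ f` with `w` of measure below `m`. -/
def relationsBelow (m : α) : Submodule F M :=
  Submodule.span F {x | ∃ w f, R w f ∧ μ w < m ∧ x = b w - f}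

/-- The span of the relations `b w - f` for all reductions `w ↦ f`. -/
def relations : Submodule F M :=
  Submodule.span F {x | ∃ w f, R w f ∧ x = b w - f}

variable {b μ R}

theorem sub_mem_relationsBelow {w : W} {f : M} {m : α} (h : R w f) (hm : μ w < m) :
    b w - f ∈ relationsBelow b μ R m :=
  Submodule.subset_span ⟨w, f, h, hm, rfl⟩

theorem relationsBelow_mono {m m' : α} (h : m ≤ m') :
    relationsBelow b μ R m ≤ relationsBelow b μ R m' := by
  refine Submodule.span_mono ?_
  rintro x ⟨w, f, hw, hm, rfl⟩
  exact ⟨w, f, hw, hm.trans_le h, rfl⟩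

/-- Bergman's diamond lemma in linear form: if all reductions decrease the measure and any two
reductions of the same basis element differ by lower relations, then the relations lie in the
kernel of a linear map that sends the irreducible basis elements to a basis. -/
theorem exists_normalForm [WellFoundedLT α]
    (hlow : ∀ w f, R w f → ∀ v ∈ (b.repr f).support, μ v < μ w)
    (hconf : ∀ w f g, R w f → R w g → f - g ∈ relationsBelow b μ R (μ w)) :
    ∃ N : M →ₗ[F] ({w // ∀ f, ¬ R w f} →₀ F),
      (∀ w, N (b w.1) = Finsupp.single w 1) ∧ relations b R ≤ LinearMap.ker N := by
  classical
  have wf : WellFounded (InvImage (· < ·) μ) := InvImage.wf μ wellFounded_lt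
  let step : (w : W) → ((v : W) → μ v < μ w → ({w // ∀ f, ¬ R w f} →₀ F)) →
      ({w // ∀ f, ¬ R w f} →₀ F) := fun w rec =>
    if h : ∃ f, R w f then
      (b.repr h.choose).sum fun v c => if hv : μ v < μ w then c • rec v hv else 0
    else Finsupp.single ⟨w, not_exists.1 h⟩ 1
  let N₀ : W → ({w // ∀ f, ¬ R w f} →₀ F) := wf.fix step
  have hN₀ : ∀ w, N₀ w = step w fun v _ => N₀ v := fun w => wf.fix_eq step w
  let N := b.constr F N₀
  have hNb : ∀ w, N (b w) = N₀ w := fun w => b.constr_basis F N₀ w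
  have hred : ∀ w, (∃ f, R w f) → ∃ f, R w f ∧ N (b w) = N f := by
    intro w h
    refine ⟨h.choose, h.choose_spec, ?_⟩
    rw [hNb, hN₀, Module.Basis.constr_apply]
    simp only [step, dif_pos h]
    refine Finsupp.sum_congr fun v hv => ?_
    rw [dif_pos (hlow w _ h.choose_spec v hv)]
  -- The choice does not matter: by induction `N` kills all relations below `w`, hence `f - g` for
  -- the chosen reduction `g`, and `N (b w) = N g`.
  have hkill : ∀ w f, R w f → N (b w - f) = 0 := by
    intro w
    induction w using wf.induction with
    | _ w ih =>
      intro f hf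
      obtain ⟨g, hg, hNg⟩ := hred w ⟨f, hf⟩
      have hle : relationsBelow b μ R (μ w) ≤ LinearMap.ker N := by
        rw [relationsBelow, Submodule.span_le]
        rintro x ⟨v, h, hv, hlt, rfl⟩
        exact ih v hlt h hv
      have := hle (hconf w g f hg hf)
      rwa [LinearMap.mem_ker, map_sub, ← hNg, ← map_sub] at this
  refine ⟨N, fun w => ?_, ?_⟩
  · have hw : ¬ ∃ f, R w.1 f := not_exists.2 w.2
    rw [hNb, hN₀]
    simp only [step, dif_neg hw]
  · rw [relations, Submodule.span_le]
    rintro x ⟨w, f, hf, rfl⟩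
    exact hkill w f hf

/-- Independence: a dependence among the images comes from an element of `ker π`, which the normal
form map kills although it separates irreducible elements. Spanning: descend along reductions. -/
theorem exists_basis_of_reductions [WellFoundedLT α]
    (hlow : ∀ w f, R w f → ∀ v ∈ (b.repr f).support, μ v < μ w)
    (hconf : ∀ w f g, R w f → R w g → f - g ∈ relationsBelow b μ R (μ w))
    {Q : Type*} [AddCommGroup Q] [Module F Q] (π : M →ₗ[F] Q) (hπ : Function.Surjective π)
    (hker : LinearMap.ker π = relations b R) :
    ∃ c : Module.Basis {w // ∀ f, ¬ R w f} F Q, ∀ w, c w = π (b w.1) := by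
  obtain ⟨N, hN, hNker⟩ := exists_normalForm hlow hconf
  have hli : LinearIndependent F fun w : {w // ∀ f, ¬ R w f} => π (b w.1) := by
    rw [linearIndependent_iff]
    intro l hl
    have h1 : Finsupp.linearCombination F (fun w : {w // ∀ f, ¬ R w f} => b w.1) l ∈
        LinearMap.ker π := by
      rw [LinearMap.mem_ker, ← hl, Finsupp.linearCombination_apply, Finsupp.linearCombination_apply,
        map_finsuppSum]
      simp
    rw [hker] at h1
    have h2 := hNker h1
    rw [LinearMap.mem_ker, Finsupp.linearCombination_apply, map_finsuppSum] at h2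
    simpa [hN] using h2
  have hspan : ⊤ ≤ Submodule.span F
      (Set.range fun w : {w // ∀ f, ¬ R w f} => π (b w.1)) := by
    have wf : WellFounded (InvImage (· < ·) μ) := InvImage.wf μ wellFounded_lt
    have hb : ∀ w, π (b w) ∈ Submodule.span F
        (Set.range fun w : {w // ∀ f, ¬ R w f} => π (b w.1)) := by
      intro w
      induction w using wf.induction with
      | _ w ih =>
        by_cases hw : ∃ f, R w f
        · obtain ⟨f, hf⟩ := hw
          have h0 : π (b w - f) = 0 := by
            rw [← LinearMap.mem_ker, hker]
            exact Submodule.subset_span ⟨w, f, hf, rfl⟩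
          rw [map_sub, sub_eq_zero] at h0
          rw [h0, ← b.linearCombination_repr f, Finsupp.linearCombination_apply, map_finsuppSum]
          refine Submodule.sum_mem _ fun v hv => ?_
          simp only [map_smul]
          exact Submodule.smul_mem _ _ (ih v (hlow w f hf v hv))
        · exact Submodule.subset_span ⟨⟨w, not_exists.1 hw⟩, rfl⟩
    rintro q -
    obtain ⟨x, rfl⟩ := hπ q
    rw [← b.linearCombination_repr x, Finsupp.linearCombination_apply, map_finsuppSum]
    refine Submodule.sum_mem _ fun v _ => ?_
    simp only [map_smul]
    exact Submodule.smul_mem _ _ (hb v)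
  exact ⟨Module.Basis.mk hli hspan, fun w => Module.Basis.mk_apply hli hspan w⟩

end Diamond

/-! ### The measure on words: length, then inversions. -/

section Inversions

variable {I : Type*} [LinearOrder I]

/-- The number of inversions of a word. -/
def List.inversions : List I → ℕ
  | [] => 0
  | a :: l => l.countP (· < a) + l.inversions

/-- A letter of `a` sees the same multiset to its right before and after the swap, so only the pair
itself matters. -/
theorem List.inversions_append_swap (a b : List I) {i j : I} (h : i < j) :
    (a ++ i :: j :: b).inversions < (a ++ j :: i :: b).inversions := by
  induction a with
  | nil => simp [List.inversions, h, h.not_gt]; omega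
  | cons c a ih =>
    simp only [List.cons_append, List.inversions]
    have : (a ++ i :: j :: b).countP (· < c) = (a ++ j :: i :: b).countP (· < c) :=
      ((List.Perm.swap j i b).append_left a).countP_eq _
    omega

/-- Words are compared by length, then by number of inversions. -/
def wordMeasure (w : FreeMonoid I) : ℕ ×ₗ ℕ := toLex (w.length, w.toList.inversions)

theorem wordMeasure_lt_of_length_lt {v w : FreeMonoid I} (h : v.length < w.length) :
    wordMeasure v < wordMeasure w :=
  Prod.Lex.toLex_lt_toLex.2 (Or.inl h)

theorem wordMeasure_swap (a b : FreeMonoid I) {i j : I} (h : i < j) :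
    wordMeasure (a * (.of i * .of j) * b) < wordMeasure (a * (.of j * .of i) * b) := by
  refine Prod.Lex.toLex_lt_toLex.2 (Or.inr ⟨?_, ?_⟩)
  · simp
  · have := List.inversions_append_swap a.toList b.toList h
    simpa [FreeMonoid.toList_mul, FreeMonoid.toList_of] using this

/-- The letter `j` moves right past the copies of `i` one swap at a time, each swap lowering the
measure. -/
theorem wordMeasure_pow_mul_of_lt {i j : I} (h : i < j) (a b : FreeMonoid I) (k l : ℕ) :
    wordMeasure (a * (.of i ^ (k + 1) * .of j * .of i ^ l) * b) <
      wordMeasure (a * (.of j * .of i ^ (k + 1 + l)) * b) := by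
  induction k generalizing l with
  | zero =>
    have := wordMeasure_swap a (.of i ^ l * b) h
    simpa [pow_add, mul_assoc] using this
  | succ k ih =>
    have h1 := wordMeasure_swap (a * .of i ^ (k + 1)) (.of i ^ l * b) h
    have h2 := ih (l + 1)
    rw [show k + 1 + (l + 1) = k + 1 + 1 + l by omega] at h2
    refine lt_trans ?_ h2
    rw [pow_succ (FreeMonoid.of i) (k + 1), pow_succ' (FreeMonoid.of i) l]
    simpa only [mul_assoc] using h1

theorem wordMeasure_mul_pow_of_lt {i j : I} (h : i < j) (a b : FreeMonoid I) (k l : ℕ) :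
    wordMeasure (a * (.of j ^ k * .of i * .of j ^ (l + 1)) * b) <
      wordMeasure (a * (.of j ^ (k + (l + 1)) * .of i) * b) := by
  induction l generalizing k with
  | zero =>
    have := wordMeasure_swap (a * .of j ^ k) b h
    simpa [pow_add, mul_assoc] using this
  | succ l ih =>
    have h1 := wordMeasure_swap (a * .of j ^ k) (.of j ^ (l + 1) * b) h
    have h2 := ih (k + 1)
    rw [show k + 1 + (l + 1) = k + (l + 1 + 1) by omega] at h2
    refine lt_trans ?_ h2
    rw [pow_succ (FreeMonoid.of j) k, pow_succ' (FreeMonoid.of j) (l + 1)]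
    simpa only [mul_assoc] using h1

end Inversions

/-- The sum telescopes. -/
theorem Finset.sum_pow_mul_commutator_mul_pow {A : Type*} [Ring A] (x y : A) (n : ℕ) :
    ∑ k ∈ Finset.range n, x ^ k * (y * x - x * y) * x ^ (n - 1 - k) = y * x ^ n - x ^ n * y := by
  induction n with
  | zero => simp
  | succ n ih =>
    have h : ∀ k ∈ Finset.range n, x ^ k * (y * x - x * y) * x ^ (n + 1 - 1 - k) =
        x ^ k * (y * x - x * y) * x ^ (n - 1 - k) * x := by
      intro k hk
      have hk := Finset.mem_range.1 hk
      rw [mul_assoc _ _ x, ← pow_succ, show n - 1 - k + 1 = n + 1 - 1 - k by omega]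
    rw [Finset.sum_range_succ, Finset.sum_congr rfl h, ← Finset.sum_mul, ih, pow_succ x n]
    simp only [Nat.add_sub_cancel, Nat.sub_self, pow_zero, mul_one]
    noncomm_ring

namespace ReducedEnveloping

/-! ### Rewriting rules, and Lie identities modulo short relations. -/

section Reductions

variable {F L I : Type*} [Field F] [LieRing L] [LieAlgebra F L] (e : Module.Basis I F L)

/-- A word as an element of the free algebra. -/
noncomputable abbrev word (F : Type*) [Field F] {I : Type*} :
    FreeMonoid I →* MonoidAlgebra F (FreeMonoid I) :=
  MonoidAlgebra.of F (FreeMonoid I)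

theorem basis_apply_eq_word (w : FreeMonoid I) :
    MonoidAlgebra.basis (FreeMonoid I) F w = word F w := rfl

/-- The linear map from a Lie algebra with basis `e` to the free algebra on the index set that
sends `e i` to the letter `i`. -/
noncomputable def letters : L →ₗ[F] MonoidAlgebra F (FreeMonoid I) :=
  e.constr F fun i => word F (.of i)

theorem letters_basis (i : I) : letters e (e i) = word F (.of i) :=
  e.constr_basis F _ i

variable [LinearOrder I] (p : ℕ) (φ : L → L) (S : Module.Dual F L)

/-- The basic rewriting rules of the reduced enveloping algebra: sorting two adjacent letters, and
replacing a `p`-th power of a letter. -/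
inductive BasicReduction : FreeMonoid I → MonoidAlgebra F (FreeMonoid I) → Prop
  | swap {i j : I} (h : i < j) : BasicReduction (.of j * .of i)
      (word F (.of i) * word F (.of j) + letters e ⁅e j, e i⁆)
  | pow (i : I) : BasicReduction (.of i ^ p)
      (letters e (φ (e i)) + algebraMap F _ (S (e i) ^ p))

/-- A basic reduction applied to a factor of a word. -/
inductive Reduction : FreeMonoid I → MonoidAlgebra F (FreeMonoid I) → Prop
  | intro (a b : FreeMonoid I) {w : FreeMonoid I} {f : MonoidAlgebra F (FreeMonoid I)}
      (h : BasicReduction e p φ S w f) : Reduction (a * w * b) (word F a * f * word F b)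

/-- The span of the relations that involve words of measure below `m`. -/
noncomputable abbrev relBelow (m : ℕ ×ₗ ℕ) : Submodule F (MonoidAlgebra F (FreeMonoid I)) :=
  relationsBelow (MonoidAlgebra.basis (FreeMonoid I) F) wordMeasure (Reduction e p φ S) m

/-- The span of the relations that involve words of length at most `d`. -/
noncomputable abbrev relLength (d : ℕ) : Submodule F (MonoidAlgebra F (FreeMonoid I)) :=
  relBelow e p φ S (toLex (d + 1, 0))

variable {e p φ S}

/-- No inversion count is below `0`, so the bound excludes all words of length `d + 1`. -/
theorem wordMeasure_lt_toLex {w : FreeMonoid I} {d : ℕ} :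
    wordMeasure w < toLex (d + 1, 0) ↔ w.length ≤ d := by
  rw [wordMeasure, Prod.Lex.toLex_lt_toLex]
  simp

theorem mem_relBelow {a b w : FreeMonoid I} {f : MonoidAlgebra F (FreeMonoid I)} {m : ℕ ×ₗ ℕ}
    (h : BasicReduction e p φ S w f) (hm : wordMeasure (a * w * b) < m) :
    word F a * (word F w - f) * word F b ∈ relBelow e p φ S m := by
  have := sub_mem_relationsBelow (b := MonoidAlgebra.basis (FreeMonoid I) F)
    (Reduction.intro a b h) hm
  rwa [basis_apply_eq_word, map_mul, map_mul, ← sub_mul, ← mul_sub] at this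

theorem swap_mem_relBelow {i j : I} (h : i < j) (a b : FreeMonoid I) {m : ℕ ×ₗ ℕ}
    (hm : wordMeasure (a * (.of j * .of i) * b) < m) :
    word F a * (word F (.of j) * word F (.of i) -
      (word F (.of i) * word F (.of j) + letters e ⁅e j, e i⁆)) * word F b ∈
        relBelow e p φ S m := by
  rw [← map_mul (word F) (.of j)]
  exact mem_relBelow (.swap h) hm

theorem pow_mem_relBelow (i : I) (a b : FreeMonoid I) {m : ℕ ×ₗ ℕ}
    (hm : wordMeasure (a * .of i ^ p * b) < m) :
    word F a * (word F (.of i) ^ p - (letters e (φ (e i)) + algebraMap F _ (S (e i) ^ p))) *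
      word F b ∈ relBelow e p φ S m := by
  rw [← map_pow]
  exact mem_relBelow (.pow i) hm

theorem word_mul_mem_relLength {d n : ℕ} {x : MonoidAlgebra F (FreeMonoid I)}
    (hx : x ∈ relLength e p φ S d) (a b : FreeMonoid I) (h : a.length + d + b.length ≤ n) :
    word F a * x * word F b ∈ relLength e p φ S n := by
  induction hx using Submodule.span_induction with
  | mem x hx =>
    obtain ⟨_, _, ⟨c, c', hr⟩, hm, rfl⟩ := hx
    rw [wordMeasure_lt_toLex] at hm
    have := mem_relBelow (a := a * c) (b := c' * b) (m := toLex (n + 1, 0)) hr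
      (by rw [wordMeasure_lt_toLex]; simp only [FreeMonoid.length_mul] at hm ⊢; omega)
    rw [basis_apply_eq_word]
    convert this using 1
    simp only [map_mul]
    noncomm_ring
  | zero => simp
  | add x y _ _ hx hy => rw [mul_add, add_mul]; exact add_mem hx hy
  | smul c x _ hx => rw [mul_smul_comm, smul_mul_assoc]; exact Submodule.smul_mem _ c hx

theorem relLength_mono {d n : ℕ} (h : d ≤ n) : relLength e p φ S d ≤ relLength e p φ S n :=
  relationsBelow_mono (Prod.Lex.toLex_mono (by simpa using h))

/-- A strict drop in length makes inversions irrelevant. Thus Lie identities only need their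
relations bounded in length. -/
theorem word_mul_mem_relBelow {d : ℕ} {x : MonoidAlgebra F (FreeMonoid I)}
    (hx : x ∈ relLength e p φ S d) (a b w : FreeMonoid I)
    (h : a.length + d + b.length < w.length) :
    word F a * x * word F b ∈ relBelow e p φ S (wordMeasure w) := by
  refine relationsBelow_mono ?_ (word_mul_mem_relLength hx a b le_rfl)
  rw [wordMeasure, Prod.Lex.toLex_le_toLex']
  exact ⟨h, fun _ => Nat.zero_le _⟩

theorem letters_mul_mem_relLength {d : ℕ} {x : MonoidAlgebra F (FreeMonoid I)}
    (hx : x ∈ relLength e p φ S d) (y : L) : letters e y * x ∈ relLength e p φ S (d + 1) := by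
  induction e.mem_span y using Submodule.span_induction with
  | mem y hy =>
    obtain ⟨i, rfl⟩ := hy
    have := word_mul_mem_relLength (n := d + 1) hx (.of i) 1 (by simp; omega)
    rwa [map_one, mul_one, ← letters_basis e] at this
  | zero => simp
  | add y z _ _ hy hz => rw [map_add, add_mul]; exact add_mem hy hz
  | smul c y _ hy => rw [map_smul, smul_mul_assoc]; exact Submodule.smul_mem _ c hy

theorem mul_letters_mem_relLength {d : ℕ} {x : MonoidAlgebra F (FreeMonoid I)}
    (hx : x ∈ relLength e p φ S d) (y : L) : x * letters e y ∈ relLength e p φ S (d + 1) := by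
  induction e.mem_span y using Submodule.span_induction with
  | mem y hy =>
    obtain ⟨i, rfl⟩ := hy
    have := word_mul_mem_relLength (n := d + 1) hx 1 (.of i) (by simp)
    rwa [map_one, one_mul, ← letters_basis e] at this
  | zero => simp
  | add y z _ _ hy hz => rw [map_add, mul_add]; exact add_mem hy hz
  | smul c y _ hy => rw [map_smul, mul_smul_comm]; exact Submodule.smul_mem _ c hy

/-- By bilinearity it suffices to treat basis vectors: one swap rule for each order of the indices,
up to skew-symmetry, and nothing to prove on the diagonal. -/
theorem letters_commutator_mem (x y : L) :
    letters e x * letters e y - letters e y * letters e x - letters e ⁅x, y⁆ ∈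
      relLength e p φ S 2 := by
  induction e.mem_span x using Submodule.span_induction with
  | mem x hx =>
    obtain ⟨i, rfl⟩ := hx
    induction e.mem_span y using Submodule.span_induction with
    | mem y hy =>
      obtain ⟨j, rfl⟩ := hy
      have key : ∀ i j : I, i < j → letters e (e j) * letters e (e i) -
          letters e (e i) * letters e (e j) - letters e ⁅e j, e i⁆ ∈ relLength e p φ S 2 := by
        intro i j h
        have := swap_mem_relBelow (e := e) (p := p) (φ := φ) (S := S) h 1 1
          (m := toLex (2 + 1, 0)) (by rw [wordMeasure_lt_toLex]; simp)
        rwa [map_one, one_mul, mul_one, ← letters_basis e, ← letters_basis e, ← sub_sub] at this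
      rcases lt_trichotomy i j with h | rfl | h
      · have := neg_mem (key i j h)
        rw [← lie_skew, map_neg]
        convert this using 1
        abel
      · simp
      · exact key j i h
    | zero => simp
    | add y z _ _ hy hz =>
      convert add_mem hy hz using 1
      simp only [lie_add, map_add]
      noncomm_ring
    | smul c y _ hy =>
      convert Submodule.smul_mem _ c hy using 1
      simp only [lie_smul, map_smul, smul_sub, smul_mul_assoc, mul_smul_comm]
  | zero => simp
  | add x z _ _ hx hz =>
    convert add_mem hx hz using 1
    simp only [add_lie, map_add]
    noncomm_ring
  | smul c x _ hx =>
    convert Submodule.smul_mem _ c hx using 1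
    simp only [smul_lie, map_smul, smul_sub, smul_mul_assoc, mul_smul_comm]

/-- Each commutator with `x` lengthens the words by one. For `n = p - 1` the bound is `p`, one less
than the length of the overlaps `j i^p` and `j^p i`. -/
theorem ad_pow_letters_mem (x y : L) (n : ℕ) :
    (LieAlgebra.ad F (MonoidAlgebra F (FreeMonoid I)) (letters e x) ^ n) (letters e y) -
      letters e ((LieAlgebra.ad F L x ^ n) y) ∈ relLength e p φ S (n + 1) := by
  induction n with
  | zero => simp
  | succ n ih =>
    have h := add_mem (sub_mem (letters_mul_mem_relLength ih x) (mul_letters_mem_relLength ih x))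
      (relLength_mono (by omega) (letters_commutator_mem x ((LieAlgebra.ad F L x ^ n) y)))
    rw [pow_succ', pow_succ', Module.End.mul_apply, Module.End.mul_apply, LieAlgebra.ad_apply,
      LieAlgebra.ad_apply, LieRing.of_associative_ring_bracket]
    convert h using 1
    noncomm_ring

theorem commutator_letters_pow_mem {x y : L} (h : ⁅x, y⁆ = 0) (n : ℕ) :
    letters e x * letters e y ^ n - letters e y ^ n * letters e x ∈
      relLength e p φ S (n + 1) := by
  induction n with
  | zero => simp
  | succ n ih =>
    have h1 := letters_commutator_mem (e := e) (p := p) (φ := φ) (S := S) x y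
    rw [h, map_zero, sub_zero] at h1
    have h2 : ∀ m, letters e y ^ m * (letters e x * letters e y - letters e y * letters e x) ∈
        relLength e p φ S (m + 2) := by
      intro m
      induction m with
      | zero => simpa using h1
      | succ m ih =>
        rw [pow_succ', mul_assoc]
        exact relLength_mono (by omega) (letters_mul_mem_relLength ih y)
    convert add_mem (mul_letters_mem_relLength ih y) (h2 n) using 1
    rw [pow_succ]
    noncomm_ring

end Reductions

end ReducedEnveloping

/-! ### Resolution of the overlaps. -/

theorem FreeMonoid.length_of_pow {I : Type*} (i : I) (n : ℕ) : (of i ^ n).length = n := by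
  induction n with
  | zero => rfl
  | succ n ih => rw [pow_succ, length_mul, ih, length_of]

/-- The two reductions of `y x^(n+1)` are compared by telescoping the passage of `y` through
`x^(n+1)`. The summand `k = 0` is absorbed on the left; its relation involves the ambiguous word
itself, whereas those of the other summands lie strictly below. With `n + 1 = p`, the sum of the
`x^k l x^(n-k)` is `(ad x)^(p-1) l`, and `-m` is its value in the Lie algebra. -/
theorem swap_pow_ambiguity {A : Type*} [Ring A] (x y l f c m : A) (hc : c * y = y * c) (n : ℕ) :
    (x * y + l) * x ^ n - y * (f + c) = (x ^ (n + 1) - (f + c)) * y +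
      ∑ k ∈ Finset.range n, x ^ (k + 1) * (y * x - (x * y + l)) * x ^ (n - (k + 1)) +
      (∑ k ∈ Finset.range (n + 1), x ^ k * l * x ^ (n - k) - -m) + (f * y - y * f - m) := by
  have htel := Finset.sum_pow_mul_commutator_mul_pow x y (n + 1)
  have hr : y * x - x * y = (y * x - (x * y + l)) + l := by abel
  rw [Nat.add_sub_cancel, hr] at htel
  simp only [mul_add _ (y * x - (x * y + l)), add_mul _ _ (x ^ (n - _)),
    Finset.sum_add_distrib] at htel
  rw [Finset.sum_range_succ', pow_zero, one_mul, Nat.sub_zero, sub_mul (y * x), mul_assoc y x,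
    ← pow_succ'] at htel
  rw [mul_add, sub_mul, add_mul f, hc]
  rw [← sub_eq_zero] at htel ⊢
  refine neg_eq_zero.1 (Eq.trans ?_ htel)
  abel

/-- The mirror image for `x^(n+1) y`: here the last summand `k = n` is absorbed. -/
theorem pow_swap_ambiguity {A : Type*} [Ring A] (x y l f c m : A) (hc : c * y = y * c) (n : ℕ) :
    (f + c) * y - x ^ n * (y * x + l) = (f * y - y * f - m) - y * (x ^ (n + 1) - (f + c)) -
      ∑ k ∈ Finset.range n, x ^ k * (x * y - (y * x + l)) * x ^ (n - k) -
      (∑ k ∈ Finset.range (n + 1), x ^ k * l * x ^ (n - k) - m) := by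
  have htel := Finset.sum_pow_mul_commutator_mul_pow x y (n + 1)
  have hr : y * x - x * y = - (x * y - (y * x + l)) + - l := by abel
  rw [Nat.add_sub_cancel, hr] at htel
  simp only [mul_add _ (- (x * y - (y * x + l))), add_mul _ _ (x ^ (n - _)),
    Finset.sum_add_distrib, mul_neg, neg_mul, Finset.sum_neg_distrib] at htel
  rw [Finset.sum_range_succ, Nat.sub_self, pow_zero, mul_one, mul_sub (x ^ n), ← mul_assoc _ x,
    ← pow_succ] at htel
  rw [mul_sub y, mul_add y, add_mul f, hc]
  rw [← sub_eq_zero] at htel ⊢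
  refine neg_eq_zero.1 (Eq.trans ?_ htel)
  abel

namespace ReducedEnveloping

section Ambiguities

variable {F L I : Type*} [Field F] [LieRing L] [LieAlgebra F L] {e : Module.Basis I F L}
  [LinearOrder I] {p : ℕ} {φ : L → L} {S : Module.Dual F L}

theorem swap_swap_mem {i j k : I} (hij : i < j) (hjk : j < k) (a b : FreeMonoid I) :
    word F a * ((word F (.of j) * word F (.of k) + letters e ⁅e k, e j⁆) * word F (.of i) -
      word F (.of k) * (word F (.of i) * word F (.of j) + letters e ⁅e j, e i⁆)) * word F b ∈
        relBelow e p φ S (wordMeasure (a * (.of k * .of j * .of i) * b)) := by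
  have hik := hij.trans hjk
  have m1 := wordMeasure_swap a (.of i * b) hjk
  have m2 := wordMeasure_swap (a * .of k) b hij
  have m3 := wordMeasure_swap (a * .of j) b hik
  have m4 := wordMeasure_swap a (.of j * b) hik
  have h1 := swap_mem_relBelow (e := e) (p := p) (φ := φ) (S := S) hik (a * .of j) b
    (m := wordMeasure (a * (.of k * .of j * .of i) * b)) (by simpa only [mul_assoc] using m1)
  have h2 := swap_mem_relBelow (e := e) (p := p) (φ := φ) (S := S) hij a (.of k * b)
    (m := wordMeasure (a * (.of k * .of j * .of i) * b))
    (by simp only [mul_assoc] at m1 m3 ⊢; exact m3.trans m1)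
  have h3 := swap_mem_relBelow (e := e) (p := p) (φ := φ) (S := S) hik a (.of j * b)
    (m := wordMeasure (a * (.of k * .of j * .of i) * b)) (by simpa only [mul_assoc] using m2)
  have h4 := swap_mem_relBelow (e := e) (p := p) (φ := φ) (S := S) hjk (a * .of i) b
    (m := wordMeasure (a * (.of k * .of j * .of i) * b))
    (by simp only [mul_assoc] at m2 m4 ⊢; exact m4.trans m2)
  -- After sorting `k j i` along both routes only brackets with one letter remain; these relations
  -- have length two, below the length three of the overlap, and the Jacobi identity `hJ` cancels
  -- the rest.
  have hC : ∀ x y : L, word F a * (letters e x * letters e y - letters e y * letters e x -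
      letters e ⁅x, y⁆) * word F b ∈
        relBelow e p φ S (wordMeasure (a * (.of k * .of j * .of i) * b)) := fun x y =>
    word_mul_mem_relBelow (letters_commutator_mem x y) a b _ (by simp)
  have c1 := hC ⁅e j, e i⁆ (e k)
  have c2 := hC (e j) ⁅e k, e i⁆
  have c3 := hC ⁅e k, e j⁆ (e i)
  have hJ : letters e ⁅⁅e k, e j⁆, e i⁆ =
      - letters e ⁅⁅e j, e i⁆, e k⁆ - letters e ⁅e j, ⁅e k, e i⁆⁆ := by
    rw [← map_neg, ← map_sub, lie_lie (e k) (e j) (e i), lie_skew]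
  rw [hJ] at c3
  convert add_mem (add_mem (sub_mem (sub_mem (add_mem h1 h2) h3) h4) (add_mem c1 c2)) c3 using 1
  simp only [map_mul, letters_basis]
  noncomm_ring

variable (hφ : ∀ a : L, LieAlgebra.ad F L (φ a) = LieAlgebra.ad F L a ^ p)

include hφ

/-- Both sides are `(ad x)^p y`. The overlaps use the axiom on `ad` only in this form. -/
theorem ad_pow_pred_lie (hp : p.Prime) (x y : L) :
    (LieAlgebra.ad F L x ^ (p - 1)) ⁅x, y⁆ = ⁅φ x, y⁆ := by
  rw [← LieAlgebra.ad_apply F L x y, ← Module.End.mul_apply, ← pow_succ,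
    Nat.sub_add_cancel hp.one_le, ← hφ, LieAlgebra.ad_apply]

theorem swap_pow_mem [CharP F p] (hp : p.Prime) {i j : I} (hij : i < j) (a b : FreeMonoid I) :
    word F a * ((word F (.of i) * word F (.of j) + letters e ⁅e j, e i⁆) *
      word F (.of i) ^ (p - 1) -
      word F (.of j) * (letters e (φ (e i)) + algebraMap F _ (S (e i) ^ p))) * word F b ∈
        relBelow e p φ S (wordMeasure (a * (.of j * .of i ^ p) * b)) := by
  have hp1 := Nat.sub_add_cancel hp.one_le
  have hp2 := hp.two_le
  set x := word F (.of i) with hx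
  set y := word F (.of j) with hy
  set c := algebraMap F (MonoidAlgebra F (FreeMonoid I)) (S (e i) ^ p)
  set l := letters e ⁅e j, e i⁆ with hl
  set r := y * x - (x * y + l) with hr
  have hc : c * y = y * c := Algebra.commutes _ _
  have h1 : ∑ k ∈ Finset.range (p - 1), word F a * (x ^ (k + 1) * r * x ^ (p - 1 - (k + 1))) *
      word F b ∈ relBelow e p φ S (wordMeasure (a * (.of j * .of i ^ p) * b)) := by
    refine sum_mem fun k hk => ?_
    have hk := Finset.mem_range.1 hk
    have := swap_mem_relBelow (e := e) (p := p) (φ := φ) (S := S) hij (a * .of i ^ (k + 1))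
      (.of i ^ (p - 1 - (k + 1)) * b) (m := wordMeasure (a * (.of j * .of i ^ p) * b)) (by
        have := wordMeasure_pow_mul_of_lt hij a b k (p - 1 - k)
        rw [show k + 1 + (p - 1 - k) = p by omega,
          show p - 1 - k = p - 1 - (k + 1) + 1 by omega, pow_succ' _ (p - 1 - (k + 1))] at this
        simpa only [mul_assoc] using this)
    convert this using 1
    simp only [map_mul, map_pow, mul_assoc, r, x, y, l]
  have h2 := pow_mem_relBelow (e := e) (p := p) (φ := φ) (S := S) i a (.of j * b) (m := wordMeasure (a * (.of j * .of i ^ p) * b)) (by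
    have := wordMeasure_pow_mul_of_lt hij a b (p - 1) 0
    simpa only [hp1, add_zero, pow_zero, mul_one, mul_assoc] using this)
  have h3 := word_mul_mem_relBelow (ad_pow_letters_mem (e := e) (p := p) (φ := φ) (S := S) (e i)
    ⁅e j, e i⁆ (p - 1)) a b (a * (.of j * .of i ^ p) * b) (by
      rw [hp1]; simp [FreeMonoid.length_of_pow])
  have h4 := word_mul_mem_relBelow (letters_commutator_mem (e := e) (p := p) (φ := φ) (S := S)
    (φ (e i)) (e j)) a b (a * (.of j * .of i ^ p) * b) (by
      simp [FreeMonoid.length_of_pow]; omega)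
  have had : (LieAlgebra.ad F L (e i) ^ (p - 1)) ⁅e j, e i⁆ = - ⁅φ (e i), e j⁆ := by
    rw [← lie_skew (e j) (e i), map_neg, ad_pow_pred_lie hφ hp]
  rw [had, LieAlgebra.ad_pow_pred_char hp, letters_basis, ← hl, ← hx, map_neg] at h3
  rw [letters_basis, ← hy] at h4
  have key := swap_pow_ambiguity x y l (letters e (φ (e i))) c (letters e ⁅φ (e i), e j⁆) hc (p - 1)
  rw [hp1] at key
  rw [← Finset.sum_mul, ← Finset.mul_sum] at h1
  rw [map_mul, ← hy, ← mul_assoc _ y, mul_assoc (word F a)] at h2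
  rw [key, mul_add, mul_add, mul_add, add_mul, add_mul, add_mul]
  exact add_mem (add_mem (add_mem h2 h1) h3) h4

theorem pow_swap_mem [CharP F p] (hp : p.Prime) {i j : I} (hij : i < j) (a b : FreeMonoid I) :
    word F a * ((letters e (φ (e j)) + algebraMap F _ (S (e j) ^ p)) * word F (.of i) -
      word F (.of j) ^ (p - 1) * (word F (.of i) * word F (.of j) + letters e ⁅e j, e i⁆)) *
        word F b ∈ relBelow e p φ S (wordMeasure (a * (.of j ^ p * .of i) * b)) := by
  have hp1 := Nat.sub_add_cancel hp.one_le
  have hp2 := hp.two_le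
  set x := word F (.of j) with hx
  set y := word F (.of i) with hy
  set c := algebraMap F (MonoidAlgebra F (FreeMonoid I)) (S (e j) ^ p)
  set l := letters e ⁅e j, e i⁆ with hl
  set r := x * y - (y * x + l) with hr
  have hc : c * y = y * c := Algebra.commutes _ _
  have h1 : ∑ k ∈ Finset.range (p - 1), word F a * (x ^ k * r * x ^ (p - 1 - k)) *
      word F b ∈ relBelow e p φ S (wordMeasure (a * (.of j ^ p * .of i) * b)) := by
    refine sum_mem fun k hk => ?_
    have hk := Finset.mem_range.1 hk
    have := swap_mem_relBelow (e := e) (p := p) (φ := φ) (S := S) hij (a * .of j ^ k)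
      (.of j ^ (p - 1 - k) * b) (m := wordMeasure (a * (.of j ^ p * .of i) * b)) (by
        have := wordMeasure_mul_pow_of_lt hij a b (k + 1) (p - 1 - (k + 1))
        rw [show k + 1 + (p - 1 - (k + 1) + 1) = p by omega,
          show p - 1 - (k + 1) + 1 = p - 1 - k by omega, pow_succ] at this
        simpa only [mul_assoc] using this)
    convert this using 1
    simp only [map_mul, map_pow, mul_assoc, r, x, y, l]
  have h2 := pow_mem_relBelow (e := e) (p := p) (φ := φ) (S := S) j (a * .of i) b (m := wordMeasure (a * (.of j ^ p * .of i) * b)) (by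
    have := wordMeasure_mul_pow_of_lt hij a b 0 (p - 1)
    rw [hp1, Nat.zero_add, pow_zero, one_mul] at this
    simpa only [mul_assoc] using this)
  have h3 := word_mul_mem_relBelow (ad_pow_letters_mem (e := e) (p := p) (φ := φ) (S := S) (e j)
    ⁅e j, e i⁆ (p - 1)) a b (a * (.of j ^ p * .of i) * b) (by
      rw [hp1]; simp [FreeMonoid.length_of_pow])
  have h4 := word_mul_mem_relBelow (letters_commutator_mem (e := e) (p := p) (φ := φ) (S := S)
    (φ (e j)) (e i)) a b (a * (.of j ^ p * .of i) * b) (by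
      simp [FreeMonoid.length_of_pow]; omega)
  rw [ad_pow_pred_lie hφ hp, LieAlgebra.ad_pow_pred_char hp, letters_basis, ← hl, ← hx] at h3
  rw [letters_basis, ← hy] at h4
  have key := pow_swap_ambiguity x y l (letters e (φ (e j))) c (letters e ⁅φ (e j), e i⁆) hc (p - 1)
  rw [hp1] at key
  rw [← Finset.sum_mul, ← Finset.mul_sum] at h1
  rw [map_mul, mul_assoc (word F a), ← hy] at h2
  rw [key, mul_sub, mul_sub, mul_sub, sub_mul, sub_mul, sub_mul]
  exact sub_mem (sub_mem (sub_mem h4 h2) h1) h3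

theorem pow_pow_mem (hp : p.Prime) (i : I) (k : ℕ) (a b : FreeMonoid I) :
    word F a * ((letters e (φ (e i)) + algebraMap F _ (S (e i) ^ p)) * word F (.of i) ^ k -
      word F (.of i) ^ k * (letters e (φ (e i)) + algebraMap F _ (S (e i) ^ p))) * word F b ∈
        relBelow e p φ S (wordMeasure (a * .of i ^ (p + k) * b)) := by
  have hlie : ⁅φ (e i), e i⁆ = 0 := by
    rw [← ad_pow_pred_lie hφ hp, lie_self, map_zero]
  have hp2 := hp.two_le
  have h := word_mul_mem_relBelow (commutator_letters_pow_mem (e := e) (p := p) (φ := φ) (S := S)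
    hlie k) a b (a * .of i ^ (p + k) * b) (by simp [FreeMonoid.length_of_pow]; omega)
  rw [letters_basis] at h
  convert h using 3
  rw [add_mul, mul_add, Algebra.commutes]
  abel

end Ambiguities

end ReducedEnveloping

/-! ### Factorizations of words and confluence. -/

theorem FreeMonoid.toList_of_pow {I : Type*} (i : I) (n : ℕ) :
    toList (of i ^ n) = List.replicate n i := by
  induction n with
  | zero => rfl
  | succ n ih => rw [pow_succ', toList_mul, ih, toList_of, List.replicate_succ, List.singleton_append]

theorem FreeMonoid.of_mul_eq_of_mul {I : Type*} {i j : I} {a b : FreeMonoid I}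
    (h : of i * a = of j * b) : i = j ∧ a = b :=
  List.cons.inj h

theorem FreeMonoid.of_mul_of_eq_mul {I : Type*} {i j : I} {a s : FreeMonoid I}
    (h : of j * of i = a * s) (hs : s ≠ 1) : (a = 1 ∧ s = of j * of i) ∨ (a = of j ∧ s = of i) := by
  have h' : [j, i] = a.toList ++ s.toList := h
  rcases ha : a.toList with _ | ⟨x, _ | ⟨y, l⟩⟩ <;> rw [ha] at h'
  · exact Or.inl ⟨ha, h.symm ▸ by rw [show a = 1 from ha, one_mul]⟩
  · simp only [List.cons_append, List.nil_append, List.cons.injEq] at h'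
    obtain ⟨rfl, h'⟩ := h'
    exact Or.inr ⟨ha, h'.symm⟩
  · simp only [List.cons_append, List.cons.injEq] at h'
    exact absurd (List.append_eq_nil_iff.1 h'.2.2.symm).2 hs

theorem FreeMonoid.of_pow_eq_mul {I : Type*} {i : I} {n : ℕ} {a s : FreeMonoid I}
    (h : of i ^ n = a * s) : ∃ k l, a = of i ^ k ∧ s = of i ^ l ∧ k + l = n := by
  have h' := congrArg toList h
  rw [toList_of_pow, toList_mul, eq_comm, List.append_eq_replicate_iff] at h'
  obtain ⟨h1, h2, h3⟩ := h'
  refine ⟨_, _, toList.injective ?_, toList.injective ?_, h1⟩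
  · rw [toList_of_pow]; exact h2
  · rw [toList_of_pow]; exact h3

namespace ReducedEnveloping

section Confluence

variable {F L I : Type*} [Field F] [LieRing L] [LieAlgebra F L] {e : Module.Basis I F L}
  [LinearOrder I] {p : ℕ} {φ : L → L} {S : Module.Dual F L}

/-- The word `v` begins inside `w`, with `s` the part of `w` from there on. The overlaps that can
occur are `k j i`, `j i^p`, `j^p i` and `i^(p+k)`, besides two copies of one swap; any other
position would force a strict inequality `i < i`. -/
theorem overlap_mem [CharP F p] (hp : p.Prime)
    (hφ : ∀ a : L, LieAlgebra.ad F L (φ a) = LieAlgebra.ad F L a ^ p)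
    {w v s b c d : FreeMonoid I} {f g : MonoidAlgebra F (FreeMonoid I)}
    (hw : BasicReduction e p φ S w f) (hv : BasicReduction e p φ S v g) (hws : w = c * s)
    (hs : s ≠ 1) (hd : v * d = s * b) (a : FreeMonoid I) :
    word F a * (f * word F b - word F c * g * word F d) ∈
      relBelow e p φ S (wordMeasure (a * w * b)) := by
  -- Two letters can be split off `i^p` and compared with the two letters of a swap.
  obtain ⟨q, hq⟩ : ∃ q, p = q + 2 := ⟨p - 2, by have := hp.two_le; omega⟩
  cases hw with
  | @swap i j hij =>
    obtain ⟨rfl, rfl⟩ | ⟨rfl, rfl⟩ := FreeMonoid.of_mul_of_eq_mul hws hs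
    · cases hv with
      | @swap i' j' hij' =>
        rw [mul_assoc, mul_assoc] at hd
        obtain ⟨rfl, hd'⟩ := FreeMonoid.of_mul_eq_of_mul hd
        obtain ⟨rfl, rfl⟩ := FreeMonoid.of_mul_eq_of_mul hd'
        rw [map_one, one_mul, sub_self, mul_zero]
        exact zero_mem _
      | pow k =>
        rw [hq, pow_succ', pow_succ', mul_assoc, mul_assoc, mul_assoc] at hd
        obtain ⟨rfl, hd'⟩ := FreeMonoid.of_mul_eq_of_mul hd
        obtain ⟨rfl, -⟩ := FreeMonoid.of_mul_eq_of_mul hd'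
        exact absurd hij (lt_irrefl _)
    · cases hv with
      | @swap i' j' hij' =>
        rw [mul_assoc] at hd
        obtain ⟨rfl, rfl⟩ := FreeMonoid.of_mul_eq_of_mul hd
        have := swap_swap_mem (e := e) (p := p) (φ := φ) (S := S) hij' hij a d
        convert this using 1
        · simp only [mul_assoc]
        · simp only [map_mul]; noncomm_ring
      | pow k =>
        have hp1 := Nat.sub_add_cancel hp.one_le
        rw [← hp1, pow_succ', mul_assoc] at hd
        obtain ⟨rfl, rfl⟩ := FreeMonoid.of_mul_eq_of_mul hd
        have := swap_pow_mem (e := e) (S := S) hφ hp hij a d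
        convert this using 1
        · have hk : FreeMonoid.of k ^ p = .of k * .of k ^ (p - 1) := by rw [← pow_succ', hp1]
          rw [hk]
          simp only [mul_assoc]
        · simp only [map_mul, map_pow]; noncomm_ring
  | pow i =>
    obtain ⟨k, l, rfl, rfl, hkl⟩ := FreeMonoid.of_pow_eq_mul hws
    obtain ⟨l, rfl⟩ : ∃ m, l = m + 1 := by
      rcases l with _ | l
      · exact absurd (pow_zero _) hs
      · exact ⟨l, rfl⟩
    cases hv with
    | @swap i' j' hij' =>
      rcases l with _ | l
      · rw [mul_assoc, zero_add, pow_one] at hd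
        obtain ⟨rfl, rfl⟩ := FreeMonoid.of_mul_eq_of_mul hd
        have := pow_swap_mem (e := e) (S := S) hφ hp hij' a d
        convert this using 1
        · simp only [mul_assoc]
        · rw [show p - 1 = k by omega]
          simp only [map_mul, map_pow]; noncomm_ring
      · rw [pow_succ', pow_succ', mul_assoc, mul_assoc, mul_assoc] at hd
        obtain ⟨rfl, hd'⟩ := FreeMonoid.of_mul_eq_of_mul hd
        obtain ⟨rfl, -⟩ := FreeMonoid.of_mul_eq_of_mul hd'
        exact absurd hij' (lt_irrefl _)
    | pow j =>
      have hij : j = i := by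
        rw [hq, pow_succ', pow_succ' _ l, mul_assoc, mul_assoc] at hd
        exact (FreeMonoid.of_mul_eq_of_mul hd).1
      subst hij
      rw [← hkl, add_comm, pow_add, mul_assoc] at hd
      have hb := mul_left_cancel hd
      subst hb
      have := pow_pow_mem (e := e) (S := S) hφ hp j k a d
      convert this using 1
      · rw [pow_add]; simp only [mul_assoc]
      · simp only [map_mul, map_pow]; noncomm_ring

theorem word_mem_low (w : FreeMonoid I) {m : ℕ ×ₗ ℕ} (h : wordMeasure w < m) :
    word F w ∈ Submodule.span F (word F '' {v : FreeMonoid I | wordMeasure v < m}) :=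
  Submodule.subset_span ⟨w, h, rfl⟩

theorem word_mul_letters_mul_word_mem_low (a b : FreeMonoid I) (y : L) {m : ℕ ×ₗ ℕ}
    (h : ∀ i : I, wordMeasure (a * .of i * b) < m) :
    word F a * letters e y * word F b ∈
      Submodule.span F (word F '' {v : FreeMonoid I | wordMeasure v < m}) := by
  induction e.mem_span y using Submodule.span_induction with
  | mem y hy =>
    obtain ⟨i, rfl⟩ := hy
    rw [letters_basis, ← map_mul, ← map_mul]
    exact word_mem_low _ (h i)
  | zero => simp
  | add y z _ _ hy hz => rw [map_add, mul_add, add_mul]; exact add_mem hy hz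
  | smul c y _ hy => rw [map_smul, mul_smul_comm, smul_mul_assoc]; exact Submodule.smul_mem _ c hy

theorem Reduction.mem_low (hp : p.Prime) {w : FreeMonoid I} {f : MonoidAlgebra F (FreeMonoid I)}
    (h : Reduction e p φ S w f) :
    f ∈ Submodule.span F (word F '' {v : FreeMonoid I | wordMeasure v < wordMeasure w}) := by
  have hp2 := hp.two_le
  obtain ⟨a, b, h⟩ := h
  cases h with
  | @swap i j hij =>
    rw [mul_add, add_mul]
    refine add_mem ?_ (word_mul_letters_mul_word_mem_low _ _ _ fun k => ?_)
    · rw [← map_mul, ← map_mul, ← map_mul]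
      exact word_mem_low _ (wordMeasure_swap a b hij)
    · exact wordMeasure_lt_of_length_lt (by simp)
  | pow i =>
    rw [mul_add, add_mul]
    refine add_mem (word_mul_letters_mul_word_mem_low _ _ _ fun k => ?_) ?_
    · exact wordMeasure_lt_of_length_lt (by simp [FreeMonoid.length_of_pow]; omega)
    · rw [Algebra.algebraMap_eq_smul_one, mul_smul_comm, smul_mul_assoc, mul_one, ← map_mul]
      exact Submodule.smul_mem _ _ (word_mem_low _
        (wordMeasure_lt_of_length_lt (by simp [FreeMonoid.length_of_pow]; omega)))

theorem Reduction.support_lt (hp : p.Prime) (w : FreeMonoid I)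
    (f : MonoidAlgebra F (FreeMonoid I)) (h : Reduction e p φ S w f) :
    ∀ v ∈ ((MonoidAlgebra.basis (FreeMonoid I) F).repr f).support,
      wordMeasure v < wordMeasure w :=
  (Module.Basis.mem_span_image (MonoidAlgebra.basis (FreeMonoid I) F)).1 (h.mem_low hp)

/-- Every word of `f` is lower than `w`, even in context, so putting it for `w` moves the relation
for `v` strictly below. This and its mirror image `BasicReduction.relation_mul_mem` settle disjoint
reductions. -/
theorem BasicReduction.mul_relation_mem (hp : p.Prime) {v w : FreeMonoid I}
    {f g : MonoidAlgebra F (FreeMonoid I)} (hw : BasicReduction e p φ S w f)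
    (hv : BasicReduction e p φ S v g) (a s d : FreeMonoid I) :
    word F a * f * (word F s * (word F v - g) * word F d) ∈
      relBelow e p φ S (wordMeasure (a * w * (s * v * d))) := by
  have hp2 := hp.two_le
  have key : ∀ u : FreeMonoid I, wordMeasure (u * (s * v * d)) < wordMeasure (a * w * (s * v * d)) →
      word F u * (word F s * (word F v - g) * word F d) ∈
        relBelow e p φ S (wordMeasure (a * w * (s * v * d))) := by
    intro u hu
    have := mem_relBelow (a := u * s) (b := d) hv (by simpa only [mul_assoc] using hu)
    simpa only [map_mul, mul_assoc] using this
  have hlet : 1 < w.length → ∀ y : L,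
      word F a * letters e y * (word F s * (word F v - g) * word F d) ∈
        relBelow e p φ S (wordMeasure (a * w * (s * v * d))) := by
    intro hlen y
    induction e.mem_span y using Submodule.span_induction with
    | mem y hy =>
      obtain ⟨i, rfl⟩ := hy
      rw [letters_basis, ← map_mul]
      exact key _ (wordMeasure_lt_of_length_lt (by simp; omega))
    | zero => simp
    | add y z _ _ hy hz => rw [map_add, mul_add, add_mul]; exact add_mem hy hz
    | smul c y _ hy =>
      rw [map_smul, mul_smul_comm, smul_mul_assoc]; exact Submodule.smul_mem _ c hy
  cases hw with
  | @swap i j hij =>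
    rw [mul_add, add_mul]
    refine add_mem ?_ (hlet (by simp) _)
    rw [← map_mul, ← map_mul]
    exact key _ (wordMeasure_swap a _ hij)
  | pow i =>
    rw [mul_add, add_mul]
    refine add_mem (hlet (by rw [FreeMonoid.length_of_pow]; omega) _) ?_
    rw [Algebra.algebraMap_eq_smul_one, mul_smul_comm, smul_mul_assoc, mul_one]
    exact Submodule.smul_mem _ _ (key _ (wordMeasure_lt_of_length_lt
      (by simp [FreeMonoid.length_of_pow]; omega)))

theorem BasicReduction.relation_mul_mem (hp : p.Prime) {v w : FreeMonoid I}
    {f g : MonoidAlgebra F (FreeMonoid I)} (hw : BasicReduction e p φ S w f)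
    (hv : BasicReduction e p φ S v g) (a s d : FreeMonoid I) :
    (word F a * (word F w - f) * word F s) * (g * word F d) ∈
      relBelow e p φ S (wordMeasure (a * w * s * v * d)) := by
  have hp2 := hp.two_le
  have key : ∀ u : FreeMonoid I, wordMeasure ((a * w * s) * u) < wordMeasure (a * w * s * v * d) →
      (word F a * (word F w - f) * word F s) * word F u ∈
        relBelow e p φ S (wordMeasure (a * w * s * v * d)) := by
    intro u hu
    have := mem_relBelow (a := a) (b := s * u) hw (by simpa only [mul_assoc] using hu)
    simpa only [map_mul, mul_assoc] using this
  have hlet : 1 < v.length → ∀ y : L,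
      (word F a * (word F w - f) * word F s) * (letters e y * word F d) ∈
        relBelow e p φ S (wordMeasure (a * w * s * v * d)) := by
    intro hlen y
    induction e.mem_span y using Submodule.span_induction with
    | mem y hy =>
      obtain ⟨i, rfl⟩ := hy
      rw [letters_basis, ← map_mul]
      exact key _ (wordMeasure_lt_of_length_lt (by simp; omega))
    | zero => simp
    | add y z _ _ hy hz => rw [map_add, add_mul, mul_add]; exact add_mem hy hz
    | smul c y _ hy =>
      rw [map_smul, smul_mul_assoc, mul_smul_comm]; exact Submodule.smul_mem _ c hy
  cases hv with
  | @swap i j hij =>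
    rw [add_mul, mul_add]
    refine add_mem ?_ (hlet (by simp) _)
    rw [← map_mul, ← map_mul]
    refine key _ ?_
    simpa only [mul_assoc] using wordMeasure_swap (a * w * s) d hij
  | pow i =>
    rw [add_mul, mul_add]
    refine add_mem (hlet (by rw [FreeMonoid.length_of_pow]; omega) _) ?_
    rw [Algebra.algebraMap_eq_smul_one, smul_mul_assoc, mul_smul_comm, one_mul]
    exact Submodule.smul_mem _ _ (key _ (wordMeasure_lt_of_length_lt
      (by simp [FreeMonoid.length_of_pow]; omega)))

theorem BasicReduction.sub_mem_relBelow [CharP F p] (hp : p.Prime)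
    (hφ : ∀ a : L, LieAlgebra.ad F L (φ a) = LieAlgebra.ad F L a ^ p)
    {w v : FreeMonoid I} {f g : MonoidAlgebra F (FreeMonoid I)}
    (hw : BasicReduction e p φ S w f) (hv : BasicReduction e p φ S v g)
    (a b c d : FreeMonoid I) (h : w * b = c * (v * d)) :
    word F a * f * word F b - word F (a * c) * g * word F d ∈
      relBelow e p φ S (wordMeasure (a * w * b)) := by
  have hcases : (∃ s, c = w * s ∧ b = s * (v * d)) ∨ ∃ s, w = c * s ∧ v * d = s * b :=
    List.append_eq_append_iff.1 h
  have hdisj : ∀ s, c = w * s → b = s * (v * d) →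
      word F a * f * word F b - word F (a * c) * g * word F d ∈
        relBelow e p φ S (wordMeasure (a * w * b)) := by
    rintro s rfl rfl
    have h1 := hw.mul_relation_mem hp hv a s d
    have h2 := hw.relation_mul_mem hp hv a s d
    simp only [mul_assoc] at h1 h2 ⊢
    -- `f s v - w s g = f s (v - g) - (w - f) s g`, inside the outer factors.
    convert sub_mem h1 h2 using 1
    simp only [map_mul]
    noncomm_ring
  rcases hcases with ⟨s, hc, hb⟩ | ⟨s, hc, hb⟩
  · exact hdisj s hc hb
  -- Adjacent factors count as disjoint.
  · by_cases hs : s = 1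
    · subst hs
      exact hdisj 1 (by rw [hc, mul_one, mul_one]) (by rw [hb, one_mul, one_mul])
    · have := overlap_mem hp hφ hw hv hc hs hb a
      rw [mul_sub, ← mul_assoc, ← mul_assoc, ← mul_assoc, ← map_mul (word F) a c] at this
      exact this

theorem Reduction.sub_mem_relBelow [CharP F p] (hp : p.Prime)
    (hφ : ∀ a : L, LieAlgebra.ad F L (φ a) = LieAlgebra.ad F L a ^ p)
    (w : FreeMonoid I) (f g : MonoidAlgebra F (FreeMonoid I))
    (hf : Reduction e p φ S w f) (hg : Reduction e p φ S w g) :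
    f - g ∈ relBelow e p φ S (wordMeasure w) := by
  obtain ⟨a, b, hw⟩ := hf
  rename_i u f
  generalize hx : a * u * b = x at hg
  obtain ⟨c, d, hv⟩ := hg
  rename_i v g
  rw [mul_assoc, mul_assoc] at hx
  have hcases : (∃ s, c = a * s ∧ u * b = s * (v * d)) ∨ ∃ s, a = c * s ∧ v * d = s * (u * b) :=
    List.append_eq_append_iff.1 hx
  rcases hcases with ⟨s, rfl, hs⟩ | ⟨s, rfl, hs⟩
  · have := hw.sub_mem_relBelow hp hφ hv a b s d hs
    rwa [mul_assoc a, hs, ← mul_assoc, ← mul_assoc] at this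
  · have := hv.sub_mem_relBelow hp hφ hw c d s b hs
    rw [← neg_sub]
    exact neg_mem this

theorem exists_basis_of_ker_eq_relations [CharP F p] (hp : p.Prime)
    (hφ : ∀ a : L, LieAlgebra.ad F L (φ a) = LieAlgebra.ad F L a ^ p)
    {Q : Type*} [AddCommGroup Q] [Module F Q] (π : MonoidAlgebra F (FreeMonoid I) →ₗ[F] Q)
    (hπ : Function.Surjective π)
    (hker : LinearMap.ker π =
      relations (MonoidAlgebra.basis (FreeMonoid I) F) (Reduction e p φ S)) :
    ∃ c : Module.Basis {w // ∀ f, ¬ Reduction e p φ S w f} F Q, ∀ w, c w = π (word F w.1) :=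
  exists_basis_of_reductions (μ := wordMeasure) (fun w f h => h.support_lt hp w f)
    (Reduction.sub_mem_relBelow hp hφ) π hπ hker

end Confluence

end ReducedEnveloping

/-! ### Sorted words and ordered monomials. -/

section SortedWords

variable {I : Type*} [LinearOrder I]

theorem List.exists_eq_replicate_append {i : I} {l : List I} (hl : l.Pairwise (· ≤ ·))
    (hi : ∀ j ∈ l, i ≤ j) {n : ℕ} (hn : n ≤ l.count i) : ∃ b, l = List.replicate n i ++ b := by
  induction n generalizing l with
  | zero => exact ⟨l, rfl⟩
  | succ n ih =>
    rcases l with _ | ⟨x, l⟩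
    · simp at hn
    · rw [List.pairwise_cons] at hl
      have hx : x = i := by
        by_contra hne
        have hlt : i < x := lt_of_le_of_ne (hi x (by simp)) (Ne.symm hne)
        have h0 : (x :: l).count i = 0 := by
          refine List.count_eq_zero.2 fun hmem => ?_
          rcases List.mem_cons.1 hmem with h | h
          · exact hne h.symm
          · exact absurd (hl.1 i h) hlt.not_ge
        omega
      subst hx
      rw [List.count_cons_self] at hn
      obtain ⟨b, rfl⟩ := ih hl.2 (fun j hj => hi j (List.mem_cons_of_mem _ hj)) (by omega)
      exact ⟨b, rfl⟩

/-- Equal letters of a sorted word are adjacent, so `p` occurrences of `i` contain the reducible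
factor `i^p`. -/
theorem List.exists_eq_append_replicate_append {i : I} {l : List I} (hl : l.Pairwise (· ≤ ·))
    {n : ℕ} (hn : n ≤ l.count i) : ∃ a b, l = a ++ (List.replicate n i ++ b) := by
  induction l with
  | nil => exact ⟨[], [], by simpa using hn⟩
  | cons x l ih =>
    rw [List.pairwise_cons] at hl
    by_cases hx : x = i
    · subst hx
      obtain ⟨b, hb⟩ := List.exists_eq_replicate_append (i := x) (l := x :: l)
        (List.pairwise_cons.2 hl) (by simpa using hl.1) hn
      exact ⟨[], b, hb⟩
    · rw [List.count_cons_of_ne hx] at hn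
      obtain ⟨a, b, rfl⟩ := ih hl.2 hn
      exact ⟨x :: a, b, rfl⟩

theorem Finsupp.sort_toMultiset (n : I →₀ ℕ) :
    (Finsupp.toMultiset n).sort (· ≤ ·) =
      (n.support.sort (· ≤ ·)).flatMap fun i => List.replicate (n i) i := by
  refine List.Perm.eq_of_pairwise' (r := (· ≤ ·)) (Multiset.pairwise_sort _ _) ?_ ?_
  · rw [List.pairwise_flatMap]
    refine ⟨fun a _ => List.pairwise_replicate_of_refl, ?_⟩
    refine (Finset.pairwise_sort n.support (· ≤ ·)).imp fun {a b} hab x hx y hy => ?_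
    rw [List.eq_of_mem_replicate hx, List.eq_of_mem_replicate hy]
    exact hab
  · rw [← Multiset.coe_eq_coe, Multiset.sort_eq, Finsupp.toMultiset_apply, Finsupp.sum,
      Finset.sum, ← Finset.sort_eq n.support (· ≤ ·)]
    generalize n.support.sort (· ≤ ·) = l
    rw [Multiset.map_coe, Multiset.sum_coe]
    induction l with
    | nil => rfl
    | cons a l ih =>
      rw [List.map_cons, List.sum_cons, ih, List.flatMap_cons, ← Multiset.coe_add,
        Multiset.nsmul_singleton, Multiset.coe_replicate]

theorem orderedMonomial_eq_prod_sort {A : Type*} [Ring A] (y : I → A) (n : I →₀ ℕ) :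
    orderedMonomial y n = (((Finsupp.toMultiset n).sort (· ≤ ·)).map y).prod := by
  rw [Finsupp.sort_toMultiset, orderedMonomial]
  generalize n.support.sort (· ≤ ·) = l
  induction l with
  | nil => rfl
  | cons a l ih =>
    rw [List.map_cons, List.prod_cons, ih, List.flatMap_cons, List.map_append, List.prod_append,
      List.map_replicate, List.prod_replicate]

end SortedWords

namespace ReducedEnveloping

/-! ### Irreducible words as bounded exponent vectors. -/

section IrreducibleWords

variable {F L I : Type*} [Field F] [LieRing L] [LieAlgebra F L] {e : Module.Basis I F L}
  [LinearOrder I] {p : ℕ} {φ : L → L} {S : Module.Dual F L}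

theorem irreducible_iff {w : FreeMonoid I} :
    (∀ f, ¬ Reduction e p φ S w f) ↔
      w.toList.Pairwise (· ≤ ·) ∧ ∀ i, w.toList.count i < p := by
  constructor
  · intro h
    have hs : w.toList.Pairwise (· ≤ ·) := by
      rw [← List.isChain_iff_pairwise, List.isChain_iff_forall_rel_of_append_cons_cons]
      intro j i a b hw
      by_contra hij
      have : w = .ofList a * (.of j * .of i) * .ofList b := by
        apply FreeMonoid.toList.injective
        rw [hw]
        simp [FreeMonoid.toList_mul, FreeMonoid.toList_of]
      rw [this] at h
      exact h _ (.intro _ _ (.swap (not_le.1 hij)))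
    refine ⟨hs, fun i => ?_⟩
    by_contra hi
    obtain ⟨a, b, hw⟩ := List.exists_eq_append_replicate_append hs (not_lt.1 hi)
    have : w = .ofList a * (.of i ^ p) * .ofList b := by
      apply FreeMonoid.toList.injective
      rw [hw]
      simp [FreeMonoid.toList_mul, FreeMonoid.toList_of_pow]
    rw [this] at h
    exact h _ (.intro _ _ (.pow i))
  · rintro ⟨hs, hc⟩ f ⟨a, b, h⟩
    cases h with
    | @swap i j hij =>
      rw [← List.isChain_iff_pairwise, List.isChain_iff_forall_rel_of_append_cons_cons] at hs
      refine absurd (hs (a := j) (b := i) (l₁ := a.toList) (l₂ := b.toList) ?_) hij.not_ge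
      simp [FreeMonoid.toList_mul, FreeMonoid.toList_of]
    | pow i =>
      have := hc i
      simp only [FreeMonoid.toList_mul, FreeMonoid.toList_of_pow, List.count_append,
        List.count_replicate_self] at this
      omega

variable (e p φ S) in
/-- The irreducible words are the sorted words in which every letter occurs less than `p` times. -/
noncomputable def irreducibleEquiv :
    {w : FreeMonoid I // ∀ f, ¬ Reduction e p φ S w f} ≃ {n : I →₀ ℕ // ∀ i, n i < p} where
  toFun w := ⟨Multiset.toFinsupp (w.1.toList : Multiset I), fun i => by
    rw [Multiset.toFinsupp_apply, Multiset.coe_count]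
    exact (irreducible_iff.1 w.2).2 i⟩
  invFun n := ⟨.ofList ((Finsupp.toMultiset n.1).sort (· ≤ ·)), irreducible_iff.2
    ⟨Multiset.pairwise_sort _ _, fun i => by
      rw [FreeMonoid.toList_ofList, ← Multiset.coe_count, Multiset.sort_eq,
        Finsupp.count_toMultiset]
      exact n.2 i⟩⟩
  left_inv w := by
    ext1
    apply FreeMonoid.toList.injective
    refine List.Perm.eq_of_pairwise' (r := (· ≤ ·)) (Multiset.pairwise_sort _ _)
      (irreducible_iff.1 w.2).1 ?_
    rw [← Multiset.coe_eq_coe]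
    exact (Multiset.sort_eq _ _).trans (Multiset.toFinsupp_toMultiset _)
  right_inv n := by
    ext1
    exact (congrArg Multiset.toFinsupp (Multiset.sort_eq _ _)).trans
      (Finsupp.toMultiset_toFinsupp n.1)

end IrreducibleWords

/-! ### The algebra presented by the rewriting rules. -/

section Presentation

variable {F L I : Type*} [Field F] [LieRing L] [LieAlgebra F L] (e : Module.Basis I F L)
  [LinearOrder I] (p : ℕ) (φ : L → L) (S : Module.Dual F L)

theorem word_mul_mem_relations {x : MonoidAlgebra F (FreeMonoid I)}
    (hx : x ∈ relations (MonoidAlgebra.basis (FreeMonoid I) F) (Reduction e p φ S))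
    (a b : FreeMonoid I) : word F a * x * word F b ∈
      relations (MonoidAlgebra.basis (FreeMonoid I) F) (Reduction e p φ S) := by
  induction hx using Submodule.span_induction with
  | mem x hx =>
    obtain ⟨_, _, ⟨c, d, hr⟩, rfl⟩ := hx
    refine Submodule.subset_span ⟨_, _, .intro (a * c) (d * b) hr, ?_⟩
    simp only [basis_apply_eq_word, map_mul]
    noncomm_ring
  | zero => simp
  | add x y _ _ hx hy => rw [mul_add, add_mul]; exact add_mem hx hy
  | smul c x _ hx => rw [mul_smul_comm, smul_mul_assoc]; exact Submodule.smul_mem _ c hx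

/-- The linear span of the relations is already a two-sided ideal, so the linear diamond lemma
applies to the quotient algebra. -/
theorem mul_mem_relations {x : MonoidAlgebra F (FreeMonoid I)}
    (hx : x ∈ relations (MonoidAlgebra.basis (FreeMonoid I) F) (Reduction e p φ S))
    (y z : MonoidAlgebra F (FreeMonoid I)) : y * x * z ∈
      relations (MonoidAlgebra.basis (FreeMonoid I) F) (Reduction e p φ S) := by
  have hy := (MonoidAlgebra.basis (FreeMonoid I) F).mem_span y
  have hz := (MonoidAlgebra.basis (FreeMonoid I) F).mem_span z
  induction hy using Submodule.span_induction with
  | mem y hy =>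
    obtain ⟨a, rfl⟩ := hy
    induction hz using Submodule.span_induction with
    | mem z hz =>
      obtain ⟨b, rfl⟩ := hz
      exact word_mul_mem_relations e p φ S hx a b
    | zero => simp
    | add z z' _ _ hz hz' => rw [mul_add]; exact add_mem hz hz'
    | smul c z _ hz => rw [mul_smul_comm]; exact Submodule.smul_mem _ c hz
  | zero => simp
  | add y y' _ _ hy hy' => rw [add_mul, add_mul]; exact add_mem hy hy'
  | smul c y _ hy => rw [smul_mul_assoc, smul_mul_assoc]; exact Submodule.smul_mem _ c hy

/-- The two-sided ideal of the free algebra spanned by the relations. -/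
noncomputable def relationIdeal : TwoSidedIdeal (MonoidAlgebra F (FreeMonoid I)) :=
  TwoSidedIdeal.mk' (relations (MonoidAlgebra.basis (FreeMonoid I) F) (Reduction e p φ S))
    (zero_mem _) add_mem neg_mem
    (fun {x y} h => by simpa using mul_mem_relations e p φ S h x 1)
    (fun {x y} h => by simpa using mul_mem_relations e p φ S h 1 y)

/-- The reduced enveloping algebra presented by generators `I` and the relations of the basic
reductions. -/
def Presented : Type _ := (relationIdeal e p φ S).ringCon.Quotient

noncomputable instance : Ring (Presented e p φ S) :=
  inferInstanceAs (Ring (relationIdeal e p φ S).ringCon.Quotient)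

noncomputable instance : Algebra F (Presented e p φ S) :=
  inferInstanceAs (Algebra F (relationIdeal e p φ S).ringCon.Quotient)

/-- The projection from the free algebra. -/
noncomputable def Presented.mk : MonoidAlgebra F (FreeMonoid I) →ₐ[F] Presented e p φ S :=
  RingCon.mkₐ F (relationIdeal e p φ S).ringCon

theorem Presented.mk_surjective : Function.Surjective (Presented.mk e p φ S) :=
  RingCon.mkₐ_surjective _

theorem Presented.ker_mk : LinearMap.ker (Presented.mk e p φ S).toLinearMap =
    relations (MonoidAlgebra.basis (FreeMonoid I) F) (Reduction e p φ S) := by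
  ext x
  rw [LinearMap.mem_ker]
  change Presented.mk e p φ S x = 0 ↔ _
  rw [← map_zero (Presented.mk e p φ S)]
  refine (RingCon.eq _).trans ?_
  rw [← TwoSidedIdeal.mem_iff, relationIdeal, TwoSidedIdeal.mem_mk']
  rfl

theorem Presented.mk_eq_zero {x : MonoidAlgebra F (FreeMonoid I)} :
    Presented.mk e p φ S x = 0 ↔
      x ∈ relations (MonoidAlgebra.basis (FreeMonoid I) F) (Reduction e p φ S) := by
  rw [← Presented.ker_mk]
  rfl

theorem relBelow_le_relations (m : ℕ ×ₗ ℕ) : relBelow e p φ S m ≤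
    relations (MonoidAlgebra.basis (FreeMonoid I) F) (Reduction e p φ S) :=
  Submodule.span_mono fun _ ⟨w, f, h, _, hx⟩ => ⟨w, f, h, hx⟩

/-- The canonical map from the Lie algebra. -/
noncomputable def Presented.ι : L →ₗ⁅F⁆ Presented e p φ S :=
  { (Presented.mk e p φ S).toLinearMap ∘ₗ letters e with
    map_lie' := fun {x y} => by
      have h := relBelow_le_relations e p φ S _ (letters_commutator_mem (e := e) x y)
      rw [← Presented.mk_eq_zero, map_sub, map_sub, map_mul, map_mul, sub_eq_zero] at h
      exact h.symm }

theorem Presented.ι_apply (x : L) : Presented.ι e p φ S x = Presented.mk e p φ S (letters e x) :=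
  rfl

variable {e p φ S}

theorem Presented.ι_basis_pow (i : I) :
    Presented.ι e p φ S (e i) ^ p - Presented.ι e p φ S (φ (e i)) = S (e i) ^ p • (1 : Presented e p φ S) := by
  have h := relBelow_le_relations e p φ S _ (pow_mem_relBelow (e := e) (p := p) (φ := φ) (S := S)
    (m := toLex (p + 1, 0)) i 1 1
    (by rw [wordMeasure_lt_toLex]; simp [FreeMonoid.length_of_pow]))
  rw [map_one, one_mul, mul_one, ← Presented.mk_eq_zero, map_sub, map_add, map_pow, sub_eq_zero,
    AlgHom.commutes, Algebra.algebraMap_eq_smul_one] at h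
  rw [Presented.ι_apply, Presented.ι_apply, letters_basis, h, add_sub_cancel_left]

theorem Presented.hom_ext {A : Type*} [Ring A] [Algebra F A] {f g : Presented e p φ S →ₐ[F] A}
    (h : ∀ i, f (Presented.ι e p φ S (e i)) = g (Presented.ι e p φ S (e i))) : f = g := by
  have : f.comp (Presented.mk e p φ S) = g.comp (Presented.mk e p φ S) := by
    apply MonoidAlgebra.algHom_ext'
    case single_one_left => exact Subsingleton.elim _ _
    apply FreeMonoid.hom_eq
    intro i
    have := h i
    rwa [Presented.ι_apply, letters_basis] at this
  ext x
  obtain ⟨x, rfl⟩ := Presented.mk_surjective e p φ S x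
  exact DFunLike.congr_fun this x

theorem Presented.exists_lift {A : Type*} [Ring A] [Algebra F A] (f : L →ₗ⁅F⁆ A)
    (hf : HasPCharacter p φ S f) :
    ∃ g : Presented e p φ S →ₐ[F] A, ∀ x, g (Presented.ι e p φ S x) = f x := by
  let g₀ : MonoidAlgebra F (FreeMonoid I) →ₐ[F] A :=
    MonoidAlgebra.lift F A (FreeMonoid I) (FreeMonoid.lift fun i => f (e i))
  have hw : ∀ i, g₀ (word F (.of i)) = f (e i) := fun i => by simp [g₀]
  have hl : ∀ x, g₀ (letters e x) = f x := by
    have : g₀.toLinearMap ∘ₗ letters e = (f : L →ₗ[F] A) :=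
      e.ext fun i => (congrArg g₀ (letters_basis e i)).trans (hw i)
    exact fun x => LinearMap.congr_fun this x
  have hker : ∀ x ∈ relations (MonoidAlgebra.basis (FreeMonoid I) F) (Reduction e p φ S),
      g₀ x = 0 := by
    intro x hx
    induction hx using Submodule.span_induction with
    | mem x hx =>
      obtain ⟨_, _, ⟨a, b, hr⟩, rfl⟩ := hx
      rw [basis_apply_eq_word, map_mul, map_mul, ← sub_mul, ← mul_sub, map_mul, map_mul]
      suffices h : ∀ w r, BasicReduction e p φ S w r → g₀ (word F w - r) = 0 by
        rw [h _ _ hr, mul_zero, zero_mul]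
      rintro w r (⟨hij⟩ | i)
      · rename_i i j
        simp only [map_sub, map_add, map_mul, hw, hl, LieHom.map_lie,
          LieRing.of_associative_ring_bracket]
        abel
      · simp only [map_sub, map_add, map_pow, hw, hl, AlgHom.commutes]
        rw [← sub_sub, hf, Algebra.algebraMap_eq_smul_one, smul_pow, one_pow, sub_self]
    | zero => exact map_zero _
    | add x y _ _ hx hy => rw [map_add, hx, hy, add_zero]
    | smul c x _ hx => rw [map_smul, hx, smul_zero]
  refine ⟨RingCon.liftₐ _ g₀ fun x y hxy => ?_, fun x => hl x⟩
  change g₀ x = g₀ y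
  rw [TwoSidedIdeal.rel_iff, relationIdeal, TwoSidedIdeal.mem_mk'] at hxy
  rw [← sub_eq_zero, ← map_sub]
  exact hker _ hxy

end Presentation

end ReducedEnveloping

/-- The condition is stable under scalars by `p`-semilinearity, and under sums because the `s i` in
the axiom for `φ (x + y)` cancel those in Jacobson's formula. -/
theorem HasPCharacter.of_basis {F L A I : Type*} [Field F] [LieRing L] [LieAlgebra F L] [Ring A]
    [Algebra F A] {p : ℕ} (hp : p.Prime) [CharP F p] {φ : L → L} (hφ : IsPMapping F p φ)
    {S : Module.Dual F L} {f : L →ₗ⁅F⁆ A} (e : Module.Basis I F L)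
    (h : ∀ i, f (e i) ^ p - f (φ (e i)) = S (e i) ^ p • (1 : A)) : HasPCharacter p φ S f := by
  have : Fact p.Prime := ⟨hp⟩
  have hsmul : ∀ (c : F) (x : L), f x ^ p - f (φ x) = S x ^ p • (1 : A) →
      f (c • x) ^ p - f (φ (c • x)) = S (c • x) ^ p • (1 : A) := by
    intro c x hx
    rw [hφ.map_smul, map_smul, map_smul, map_smul, smul_pow, ← smul_sub, hx, smul_smul,
      smul_eq_mul, mul_pow]
  intro x
  induction e.mem_span x using Submodule.span_induction with
  | mem x hx => obtain ⟨i, rfl⟩ := hx; exact h i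
  | zero =>
    have h0 : φ 0 = 0 := by simpa [hp.ne_zero] using hφ.map_smul 0 0
    simp [h0, hp.ne_zero]
  | add x y _ _ hx hy =>
    obtain ⟨s, hs, hadd⟩ := hφ.map_add x y
    rw [hadd, map_add, f.map_add_pow_char hp x y s hs, map_add, map_add, map_sum, map_add,
      add_pow_char, add_smul, ← hx, ← hy]
    abel
  | smul c x _ hx => exact hsmul c x hx

/-! ### Universal property, transfer of the basis, dimension. -/

section Universal

variable {F : Type u} {L : Type v} [Field F] [LieRing L] [LieAlgebra F L] {p : ℕ} {φ : L → L}
  {S : Module.Dual F L}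

theorem HasPCharacter.comp {A B : Type*} [Ring A] [Algebra F A] [Ring B] [Algebra F B]
    {f : L →ₗ⁅F⁆ A} (hf : HasPCharacter p φ S f) (g : A →ₐ[F] B) :
    HasPCharacter p φ S (g.toLieHom.comp f) := by
  intro x
  have := congrArg g (hf x)
  rwa [map_sub, map_pow, map_smul, map_one] at this

theorem IsReducedEnvelopingAlgebra.hom_ext {U : Type*} [Ring U] [Algebra F U]
    {ι : L →ₗ⁅F⁆ U} (hU : IsReducedEnvelopingAlgebra.{z} p φ S ι) {A : Type z} [Ring A]
    [Algebra F A] {g h : U →ₐ[F] A} (hgh : ∀ x, g (ι x) = h (ι x)) : g = h := by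
  obtain ⟨k, -, hk⟩ := hU.existsUnique_lift A (h.toLieHom.comp ι) (hU.hasPCharacter.comp h)
  exact (hk g hgh).trans (hk h fun _ => rfl).symm

namespace ReducedEnvelopingAlgebra

variable (F p φ S)

theorem hasPCharacter_ι : HasPCharacter p φ S (ι F p φ S) := by
  intro x
  have h : mk F p φ S (UniversalEnvelopingAlgebra.ι F x ^ p -
      UniversalEnvelopingAlgebra.ι F (φ x) - S x ^ p • 1) = mk F p φ S 0 :=
    (RingCon.eq _).2 ((TwoSidedIdeal.mem_iff _ _).1 (TwoSidedIdeal.subset_span ⟨x, rfl⟩))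
  rwa [map_zero, map_sub, map_sub, map_pow, map_smul, map_one, sub_eq_zero] at h

theorem isReducedEnvelopingAlgebra :
    IsReducedEnvelopingAlgebra.{z} p φ S (ι F p φ S) := by
  refine ⟨hasPCharacter_ι F p φ S, fun A _ _ f hf => ?_⟩
  let g₀ := UniversalEnvelopingAlgebra.lift F f
  have hg₀ : ∀ x, g₀ (UniversalEnvelopingAlgebra.ι F x) = f x :=
    UniversalEnvelopingAlgebra.lift_ι_apply F f
  have hle : reducedIdeal F p φ S ≤ TwoSidedIdeal.ker g₀.toRingHom := by
    rw [reducedIdeal, TwoSidedIdeal.span_le]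
    rintro _ ⟨x, rfl⟩
    rw [SetLike.mem_coe, TwoSidedIdeal.mem_ker]
    change g₀ _ = 0
    rw [map_sub, map_sub, map_pow, map_smul, map_one, hg₀, hg₀, hf, sub_self]
  let g : ReducedEnvelopingAlgebra F p φ S →ₐ[F] A :=
    RingCon.liftₐ _ g₀ fun x y hxy => TwoSidedIdeal.ringCon_le_iff.1 hle hxy
  refine ⟨g, fun x => hg₀ x, fun h hh => ?_⟩
  have hcomp : h.comp (mk F p φ S) = g₀ := by
    apply UniversalEnvelopingAlgebra.hom_ext
    ext x
    exact (hh x).trans (hg₀ x).symm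
  ext x
  obtain ⟨x, rfl⟩ : ∃ y, mk F p φ S y = x := RingCon.mkₐ_surjective _ x
  exact DFunLike.congr_fun hcomp x

end ReducedEnvelopingAlgebra

open ReducedEnveloping in
theorem ReducedEnvelopingAlgebra.exists_basis (hp : p.Prime) [CharP F p] (hφ : IsPMapping F p φ)
    {I : Type*} [LinearOrder I] (e : Module.Basis I F L) :
    ∃ b : Module.Basis {n : I →₀ ℕ // ∀ i, n i < p} F (ReducedEnvelopingAlgebra F p φ S),
      ∀ n, b n = orderedMonomial (fun i => ReducedEnvelopingAlgebra.ι F p φ S (e i)) n.1 := by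
  obtain ⟨c, hc⟩ := exists_basis_of_ker_eq_relations hp hφ.ad_map
    (Presented.mk e p φ S).toLinearMap (Presented.mk_surjective e p φ S) (Presented.ker_mk e p φ S)
  -- This provides the map from `u(L, S)` to the presented algebra; the converse map needs only the
  -- relations at basis vectors.
  have hchar : HasPCharacter p φ S (Presented.ι e p φ S) :=
    .of_basis hp hφ e Presented.ι_basis_pow
  obtain ⟨g, hg, -⟩ := (isReducedEnvelopingAlgebra F p φ S).existsUnique_lift _ _ hchar
  obtain ⟨h, hh⟩ := Presented.exists_lift (e := e) _ (hasPCharacter_ι F p φ S)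
  have hgh : g.comp h = AlgHom.id F _ :=
    Presented.hom_ext fun i => (congrArg g (hh (e i))).trans (hg (e i))
  have hhg : h.comp g = AlgHom.id F _ :=
    (isReducedEnvelopingAlgebra F p φ S).hom_ext fun x => (congrArg h (hg x)).trans (hh x)
  let E := AlgEquiv.ofAlgHom h g hhg hgh
  refine ⟨(c.map E.toLinearEquiv).reindex (irreducibleEquiv e p φ S), fun n => ?_⟩
  rw [Module.Basis.reindex_apply, Module.Basis.map_apply, hc, orderedMonomial_eq_prod_sort]
  have key : ∀ w : FreeMonoid I, h (Presented.mk e p φ S (word F w)) =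
      (w.toList.map fun i => ReducedEnvelopingAlgebra.ι F p φ S (e i)).prod := by
    intro w
    rw [← FreeMonoid.lift_apply]
    have : ((h.comp (Presented.mk e p φ S) : _ →* _).comp (word F)) = FreeMonoid.lift
        fun i => ReducedEnvelopingAlgebra.ι F p φ S (e i) := by
      refine FreeMonoid.hom_eq fun i => ?_
      rw [FreeMonoid.lift_eval_of, ← hh (e i), Presented.ι_apply, letters_basis]
      rfl
    exact DFunLike.congr_fun this w
  exact key _

theorem IsReducedEnvelopingAlgebra.exists_algEquiv {U : Type w} [Ring U] [Algebra F U]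
    {ι : L →ₗ⁅F⁆ U} (hU : IsReducedEnvelopingAlgebra.{max u v w} p φ S ι) :
    ∃ E : ReducedEnvelopingAlgebra F p φ S ≃ₐ[F] U,
      ∀ x, E (ReducedEnvelopingAlgebra.ι F p φ S x) = ι x := by
  let R := ReducedEnvelopingAlgebra F p φ S
  -- The universal property of `U` is tested only in universe `max u v w`, so both algebras are
  -- lifted there. That of `u(L, S)` holds in every universe and needs no lift.
  let up : R →ₐ[F] ULift.{w} R := (ULift.algEquiv (R := F) (A := R)).symm
  let up' : U →ₐ[F] ULift.{max u v} U := (ULift.algEquiv (R := F) (A := U)).symm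
  have hup' : Function.Injective up' := (ULift.algEquiv (R := F) (A := U)).symm.injective
  obtain ⟨g, hg, -⟩ := hU.existsUnique_lift (ULift.{w} R) _
    ((ReducedEnvelopingAlgebra.hasPCharacter_ι F p φ S).comp up)
  let g' : U →ₐ[F] R := (ULift.algEquiv (R := F) (A := R)).toAlgHom.comp g
  have hg' : ∀ x, g' (ι x) = ReducedEnvelopingAlgebra.ι F p φ S x := fun x =>
    congrArg ULift.down (hg x)
  obtain ⟨k, hk, -⟩ := (ReducedEnvelopingAlgebra.isReducedEnvelopingAlgebra F p φ
    S).existsUnique_lift U ι hU.hasPCharacter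
  have h1 : g'.comp k = AlgHom.id F R := by
    refine (ReducedEnvelopingAlgebra.isReducedEnvelopingAlgebra F p φ S).hom_ext fun x => ?_
    exact (congrArg g' (hk x)).trans (hg' x)
  have h2 : k.comp g' = AlgHom.id F U := by
    have h3 : up'.comp (k.comp g') = up'.comp (AlgHom.id F U) :=
      hU.hom_ext fun x => congrArg up' ((congrArg k (hg' x)).trans (hk x))
    exact AlgHom.ext fun x => hup' (DFunLike.congr_fun h3 x)
  exact ⟨AlgEquiv.ofAlgHom k g' h2 h1, hk⟩

theorem map_orderedMonomial {I A B : Type*} [LinearOrder I] [Ring A] [Ring B] (f : A →+* B)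
    (y : I → A) (n : I →₀ ℕ) : f (orderedMonomial y n) = orderedMonomial (fun i => f (y i)) n := by
  simp [orderedMonomial, map_list_prod, Function.comp_def]

theorem IsReducedEnvelopingAlgebra.exists_basis (hp : p.Prime) [CharP F p] (hφ : IsPMapping F p φ)
    {U : Type w} [Ring U] [Algebra F U] {ι : L →ₗ⁅F⁆ U}
    (hU : IsReducedEnvelopingAlgebra.{max u v w} p φ S ι)
    {I : Type*} [LinearOrder I] (e : Module.Basis I F L) :
    ∃ b : Module.Basis {n : I →₀ ℕ // ∀ i, n i < p} F U,
      ∀ n, b n = orderedMonomial (fun i => ι (e i)) n.1 := by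
  obtain ⟨E, hE⟩ := hU.exists_algEquiv
  obtain ⟨b, hb⟩ := ReducedEnvelopingAlgebra.exists_basis (S := S) hp hφ e
  refine ⟨b.map E.toLinearEquiv, fun n => ?_⟩
  rw [Module.Basis.map_apply, hb]
  refine (map_orderedMonomial E.toAlgHom.toRingHom _ _).trans ?_
  congr 1
  exact funext fun i => hE (e i)

/-- Finitely supported exponent vectors with entries below `p` on a finite index set. -/
noncomputable def boundedFinsuppEquiv (I : Type*) [Finite I] (p : ℕ) :
    {n : I →₀ ℕ // ∀ i, n i < p} ≃ (I → Fin p) where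
  toFun n i := ⟨n.1 i, n.2 i⟩
  invFun f := ⟨Finsupp.equivFunOnFinite.symm fun i => f i, fun i => (f i).2⟩
  left_inv n := by ext; rfl
  right_inv f := rfl

theorem IsReducedEnvelopingAlgebra.finrank_eq (hp : p.Prime) [CharP F p] (hφ : IsPMapping F p φ)
    {U : Type w} [Ring U] [Algebra F U] {ι : L →ₗ⁅F⁆ U}
    (hU : IsReducedEnvelopingAlgebra.{max u v w} p φ S ι) [Module.Finite F L] :
    Module.Finite F U ∧ Module.finrank F U = p ^ Module.finrank F L := by
  obtain ⟨b, -⟩ := hU.exists_basis hp hφ (Module.finBasis F L)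
  let b' := b.reindex (boundedFinsuppEquiv _ p)
  refine ⟨Module.Finite.of_basis b', ?_⟩
  rw [Module.finrank_eq_card_basis b', Fintype.card_fun, Fintype.card_fin, Fintype.card_fin]

end Universal

theorem mainTheorem5 {F : Type u} {L : Type v} [Field F] [LieRing L]
    [LieAlgebra F L] (p : ℕ) [Fact p.Prime] [CharP F p] (φ : L → L) (hφ : IsPMapping F p φ)
    (S : Module.Dual F L) :
    IsReducedEnvelopingAlgebra.{z} p φ S (ReducedEnvelopingAlgebra.ι F p φ S) ∧
    ∀ (U : Type w) [Ring U] [Algebra F U] (ι : L →ₗ⁅F⁆ U),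
      IsReducedEnvelopingAlgebra.{max u v w} p φ S ι →
        (∀ (I : Type t) [LinearOrder I] (e : Module.Basis I F L),
          ∃ b : Module.Basis {n : I →₀ ℕ // ∀ i, n i < p} F U,
            ∀ n, b n = orderedMonomial (fun i => ι (e i)) n.1) ∧
        (Module.Finite F L →
          Module.Finite F U ∧ Module.finrank F U = p ^ Module.finrank F L) :=
  ⟨ReducedEnvelopingAlgebra.isReducedEnvelopingAlgebra F p φ S, fun _ _ _ _ hU =>
    ⟨fun _ _ e => hU.exists_basis Fact.out hφ e, fun _ => hU.finrank_eq Fact.out hφ⟩⟩
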